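/- **Theorem (Interior regularity).** Let $N,m\ge 1$ and $l\ge 0$ be integers, and let $M\in\mathbb{R}$ and $\lambda>0$. There is a constant $C>0$, depending only on $N$, $m$, $l$, $M$ and $\lambda$, with the following property. Let $(a_{\alpha,\beta})_{|\alpha|=|\beta|=m}$ be real coefficients, indexed by multi-indices $\alpha,\beta\in\mathbb{N}^N$ of length $m$, with $a_{\alpha,\beta}=a_{\beta,\alpha}$, $\max_{\alpha,\beta}|a_{\alpha,\beta}|\le M$ and $$\sum_{|\alpha|=|\beta|=m}a_{\alpha,\beta}\,\xi_\alpha\xi_\beta\ \ge\ \lambda\sum_{|\alpha|=m}|\xi_\alpha|^2\qquad\text{for all real vectors }\xi=(\xi_\alpha)_{|\alpha|=m},$$ and let $\mathscr{A}=(-1)^m\sum_{|\alpha|=|\beta|=m}a_{\alpha,\beta}\,\partial^\beta\partial^\alpha$. Let $B(0,r)\subset\mathbb{R}^N$ be the open Euclidean ball, let $f\in H^l(B(0,1))$, and let $u\in H^m(B(0,1))$ be a weak solution of $\mathscr{A}u=f$ in $B(0,1)$, that is, $$\int_{B(0,1)}\sum_{|\alpha|=|\beta|=m}a_{\alpha,\beta}\,\partial^\alpha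 u\,\partial^\beta\varphi\,dx=\int_{B(0,1)}\varphi f\,dx\qquad\text{for all }\varphi\in H^m_0(B(0,1)).$$ Then $u\in H^{2m+l}(B(0,1/2))$ and $$\|u\|_{H^{2m+l}(B(0,1/2))}\le C\left(\|u\|_{H^m(B(0,1))}+\|f\|_{H^l(B(0,1))}\right).$$ Here all functions are real-valued, $\partial^\alpha$ denotes weak derivatives, $H^k(\Omega)$ is the Sobolev space with norm $\|u\|_{H^k(\Omega)}^2=\sum_{|\alpha|\le k}\|\partial^\alpha u\|_{L^2(\Omega)}^2$, and $H^k_0(\Omega)$ is the closure of $C_c^\infty(\Omega)$ in $H^k(\Omega)$. -/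

import Mathlib

open MeasureTheory
open scoped ContDiff

noncomputable section

namespace InteriorReg

/-- The space `ℝ^N` with its Euclidean norm. -/
abbrev Rn (N : ℕ) : Type := EuclideanSpace ℝ (Fin N)

/-- The (finite) set of multi-indices `α ∈ ℕ^N` of length `|α| = k`. -/
def multiIdx (N k : ℕ) : Finset (Fin N → ℕ) :=
  Finset.piAntidiag Finset.univ k

theorem mem_multiIdx {N k : ℕ} {α : Fin N → ℕ} : α ∈ multiIdx N k ↔ ∑ i, α i = k := by
  simp [multiIdx]

/-- The classical partial derivative `∂_i g`. -/
def partialD {N : ℕ} (i : Fin N) (g : Rn N → ℝ) : Rn N → ℝ :=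
  fun x => fderiv ℝ g x (EuclideanSpace.single i 1)

/-- The classical derivative `∂^α g = ∂_1^{α_1} ⋯ ∂_N^{α_N} g` (used for smooth `g`). -/
def classicalD {N : ℕ} (α : Fin N → ℕ) (g : Rn N → ℝ) : Rn N → ℝ :=
  (List.finRange N).foldr (fun i h => (partialD i)^[α i] h) g

/-- `ψ ∈ C_c^∞(Ω)`. -/
structure IsTestFunction {N : ℕ} (Ω : Set (Rn N)) (ψ : Rn N → ℝ) : Prop where
  contDiff : ContDiff ℝ ∞ ψ
  hasCompactSupport : HasCompactSupport ψ
  tsupport_subset : tsupport ψ ⊆ Ω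

/-- `v` is the weak derivative `∂^α u` in `Ω`: both are locally integrable in `Ω` and
`∫_Ω u ∂^α ψ = (-1)^{|α|} ∫_Ω v ψ` for all `ψ ∈ C_c^∞(Ω)`. -/
structure HasWeakDeriv {N : ℕ} (Ω : Set (Rn N)) (α : Fin N → ℕ) (u v : Rn N → ℝ) : Prop where
  locInt : LocallyIntegrableOn u Ω volume
  locInt_deriv : LocallyIntegrableOn v Ω volume
  integral_eq : ∀ ψ : Rn N → ℝ, IsTestFunction Ω ψ →
    ∫ x in Ω, u x * classicalD α ψ x = (-1) ^ (∑ i, α i) * ∫ x in Ω, v x * ψ x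

open Classical in
/-- The weak derivative `∂^α u` in `Ω` (a representative of it; it is unique almost everywhere
in an open set `Ω`), and `0` if there is none. -/
def weakDeriv {N : ℕ} (Ω : Set (Rn N)) (α : Fin N → ℕ) (u : Rn N → ℝ) : Rn N → ℝ :=
  if h : ∃ v, HasWeakDeriv Ω α u v then h.choose else 0

/-- `u ∈ H^k(Ω)`: `u ∈ L²(Ω)`, and for all `|α| ≤ k` the weak derivative `∂^α u` exists in `Ω`
and lies in `L²(Ω)`. -/
structure MemSobolev {N : ℕ} (k : ℕ) (Ω : Set (Rn N)) (u : Rn N → ℝ) : Prop where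
  memLp : MemLp u 2 (volume.restrict Ω)
  exists_weakDeriv : ∀ α : Fin N → ℕ, ∑ i, α i ≤ k →
    ∃ v, HasWeakDeriv Ω α u v ∧ MemLp v 2 (volume.restrict Ω)

/-- `‖u‖_{H^k(Ω)} = (∑_{|α| ≤ k} ‖∂^α u‖²_{L²(Ω)})^{1/2}`, for `u ∈ H^k(Ω)`. -/
def sobolevNorm {N : ℕ} (k : ℕ) (Ω : Set (Rn N)) (u : Rn N → ℝ) : ℝ :=
  Real.sqrt (∑ j ∈ Finset.range (k + 1), ∑ α ∈ multiIdx N j,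
    lpNorm (weakDeriv Ω α u) 2 (volume.restrict Ω) ^ 2)

/-- `φ ∈ H^k_0(Ω)`, the closure of `C_c^∞(Ω)` in `H^k(Ω)`. -/
structure MemSobolevZero {N : ℕ} (k : ℕ) (Ω : Set (Rn N)) (φ : Rn N → ℝ) : Prop where
  memSobolev : MemSobolev k Ω φ
  approx : ∀ ε : ℝ, 0 < ε → ∃ ψ : Rn N → ℝ, IsTestFunction Ω ψ ∧ sobolevNorm k Ω (φ - ψ) < ε

/-- Real coefficients `a_{α,β}`; only the values with `|α| = |β| = m` are used. -/
abbrev Coeff (N : ℕ) : Type := (Fin N → ℕ) → (Fin N → ℕ) → ℝ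

/-- `a_{α,β} = a_{β,α}` for `|α| = |β| = m`. -/
def IsSymm {N : ℕ} (m : ℕ) (a : Coeff N) : Prop :=
  ∀ α ∈ multiIdx N m, ∀ β ∈ multiIdx N m, a α β = a β α

/-- Ellipticity with constant `lam`: `∑_{|α|=|β|=m} a_{α,β} ξ_α ξ_β ≥ lam ∑_{|α|=m} |ξ_α|²` for
all real vectors `ξ = (ξ_α)_{|α|=m}`. -/
def IsEllipticWith {N : ℕ} (m : ℕ) (lam : ℝ) (a : Coeff N) : Prop :=
  ∀ ξ : (Fin N → ℕ) → ℝ,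
    lam * ∑ α ∈ multiIdx N m, |ξ α| ^ 2 ≤
      ∑ α ∈ multiIdx N m, ∑ β ∈ multiIdx N m, a α β * ξ α * ξ β

/-- `u ∈ H^m(Ω)` is a weak solution in `Ω` of `𝒜 u = f`, where
`𝒜 = (-1)^m ∑_{|α|=|β|=m} a_{α,β} ∂^β ∂^α`. -/
structure IsWeakSolution {N : ℕ} (m : ℕ) (a : Coeff N) (Ω : Set (Rn N)) (u f : Rn N → ℝ) :
    Prop where
  memSobolev : MemSobolev m Ω u
  weak_eq : ∀ φ : Rn N → ℝ, MemSobolevZero m Ω φ →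
    ∫ x in Ω, ∑ α ∈ multiIdx N m, ∑ β ∈ multiIdx N m,
        a α β * weakDeriv Ω α u x * weakDeriv Ω β φ x =
      ∫ x in Ω, φ x * f x

end InteriorReg

end

/-!
The coefficients are constant, so mollification commutes with the operator, and it suffices to
prove an estimate for smooth solutions whose constant does not depend on the solution.

For smooth solutions the estimate gains one derivative at a time (`exists_smooth_interior_bound`).
Each step is a Caccioppoli inequality (`exists_caccioppoli_bound`): with a cut-off function `η` and
`v = η w`, where `w = ∂^γ u` is a derivative of the solution, the ellipticity condition is applied
pointwise to the vector `(∂^α v(x))_{|α| = m}` and integrated. This bounds the derivatives of `v` of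
order `m` by the equation tested with `η² w`, plus commutators of `η` with `∂^α` and `∂^β`. The
commutators have lower order (`exists_commutator_bound`), and one integration by parts keeps the
derivatives of `w` of order `m` out of them (`exists_integral_commutator_bound`). Since at most `m`
derivatives of the right-hand side `∂^γ f` can be moved to the test function, `|γ| = m + l` is the
limit for `f ∈ H^l`, which gives `2 m + l` derivatives of `u`.

The mollifications `u_n` of `u` solve the mollified equation in a smaller ball
(`mollify_weak_equation`), and their norms in `H^m`, like those of the mollified right-hand sides in
`H^l`, are bounded by the norms of `u` and `f` (`derivBound_mollify`). Hence the derivatives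
`∂^α u_n` with `|α| ≤ 2 m + l` are bounded in `L²(B(0, 1/2))`, and their weak limits are the weak
derivatives of `u`, with the same bounds (`exists_weakDeriv_of_bounded`).
-/

noncomputable section

namespace InteriorReg

variable {N : ℕ}

/-! ### Calculus of the derivatives `∂^α` of smooth functions -/

/-- The multi-index `e_i` of length one. -/
abbrev unitIdx (i : Fin N) : Fin N → ℕ := Pi.single i 1

/-- Induction on multi-indices, adding one derivative at a time. -/
theorem multiIdx_induction {P : (Fin N → ℕ) → Prop} (zero : P 0)
    (add_single : ∀ α i, P α → P (α + unitIdx i)) (α : Fin N → ℕ) : P α := by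
  induction h : ∑ i, α i generalizing α with
  | zero =>
    have : α = 0 := by
      ext i
      exact Finset.sum_eq_zero_iff.mp h i (Finset.mem_univ i)
    exact this ▸ zero
  | succ n ih =>
    obtain ⟨i, -, hi⟩ : ∃ i ∈ Finset.univ, α i ≠ 0 := by
      by_contra! hc
      simp [Finset.sum_eq_zero hc] at h
    have hα : (α - unitIdx i) + unitIdx i = α := by
      ext j
      by_cases hj : j = i
      · subst hj
        simp
        omega
      · simp [hj]
    have hs : ∑ j, ((α - unitIdx i) + unitIdx i) j = n + 1 := by rw [hα, h]
    simp only [Pi.add_apply, Finset.sum_add_distrib, Finset.sum_pi_single', Finset.mem_univ,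
      if_true] at hs
    rw [← hα]
    exact add_single _ i (ih _ (by omega))

theorem sum_add_single (α : Fin N → ℕ) (i : Fin N) :
    ∑ j, (α + unitIdx i) j = ∑ j, α j + 1 := by
  simp [Finset.sum_add_distrib]

/-- A nonzero multi-index has the form `α' + e_i`. -/
theorem exists_eq_add_single {α : Fin N → ℕ} {n : ℕ} (h : ∑ j, α j = n + 1) :
    ∃ α' i, α = α' + unitIdx i ∧ ∑ j, α' j = n := by
  induction α using multiIdx_induction with
  | zero => simp at h
  | add_single α i _ =>
    rw [sum_add_single] at h
    exact ⟨α, i, rfl, by omega⟩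

/-- A multi-index of length `a + b` splits into multi-indices of lengths `a` and `b`. -/
theorem exists_eq_add_of_sum {α : Fin N → ℕ} {a b : ℕ} (h : ∑ j, α j = a + b) :
    ∃ α₁ α₂ : Fin N → ℕ, α = α₁ + α₂ ∧ ∑ j, α₁ j = a ∧ ∑ j, α₂ j = b := by
  induction b generalizing α with
  | zero => exact ⟨α, 0, by simp, by simpa using h, by simp⟩
  | succ b ih =>
    obtain ⟨α', i, rfl, h'⟩ := exists_eq_add_single (n := a + b) (by omega)
    obtain ⟨α₁, α₂, rfl, h₁, h₂⟩ := ih h'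
    exact ⟨α₁, α₂ + unitIdx i, by abel, h₁, by rw [sum_add_single, h₂]⟩

theorem partialD_smooth {g : Rn N → ℝ} (hg : ContDiff ℝ ∞ g) (i : Fin N) :
    ContDiff ℝ ∞ (partialD i g) :=
  (hg.fderiv_right (m := ∞) (by simp)).clm_apply contDiff_const

theorem partialD_comm {g : Rn N → ℝ} (hg : ContDiff ℝ ∞ g) (i j : Fin N) :
    partialD i (partialD j g) = partialD j (partialD i g) := by
  have hd : Differentiable ℝ (fderiv ℝ g) :=
    (hg.fderiv_right (m := ∞) (by simp)).differentiable (by simp)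
  have key : ∀ (k l : Fin N) (x : Rn N), partialD k (partialD l g) x =
      fderiv ℝ (fderiv ℝ g) x (EuclideanSpace.single k 1) (EuclideanSpace.single l 1) := by
    intro k l x
    unfold partialD
    rw [fderiv_clm_apply (hd x) (by fun_prop)]
    simp
  ext x
  rw [key, key]
  have hs : IsSymmSndFDerivAt ℝ g x := hg.contDiffAt.isSymmSndFDerivAt
    (by simpa using ENat.LEInfty.out)
  exact hs _ _

theorem partialD_iterate_smooth {g : Rn N → ℝ} (hg : ContDiff ℝ ∞ g) (i : Fin N) (n : ℕ) :
    ContDiff ℝ ∞ ((partialD i)^[n] g) := by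
  induction n generalizing g with
  | zero => exact hg
  | succ n ih => exact ih (partialD_smooth hg i)

theorem partialD_iterate_comm {g : Rn N → ℝ} (hg : ContDiff ℝ ∞ g) (i j : Fin N) (n : ℕ) :
    (partialD j)^[n] (partialD i g) = partialD i ((partialD j)^[n] g) := by
  induction n generalizing g with
  | zero => rfl
  | succ n ih =>
    rw [Function.iterate_succ_apply, Function.iterate_succ_apply, partialD_comm hg,
      ih (partialD_smooth hg j)]

theorem foldr_partialD_smooth {g : Rn N → ℝ} (hg : ContDiff ℝ ∞ g) (α : Fin N → ℕ)
    (L : List (Fin N)) :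
    ContDiff ℝ ∞ (L.foldr (fun i h => (partialD i)^[α i] h) g) := by
  induction L with
  | nil => exact hg
  | cons j L ih => exact partialD_iterate_smooth ih j _

theorem foldr_partialD_comm {g : Rn N → ℝ} (hg : ContDiff ℝ ∞ g) (α : Fin N → ℕ) (i : Fin N)
    (L : List (Fin N)) :
    L.foldr (fun i h => (partialD i)^[α i] h) (partialD i g) =
      partialD i (L.foldr (fun i h => (partialD i)^[α i] h) g) := by
  induction L with
  | nil => rfl
  | cons j L ih =>
    rw [List.foldr_cons, ih, partialD_iterate_comm (foldr_partialD_smooth hg α L)]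
    rfl

theorem classicalD_smooth {g : Rn N → ℝ} (hg : ContDiff ℝ ∞ g) (α : Fin N → ℕ) :
    ContDiff ℝ ∞ (classicalD α g) :=
  foldr_partialD_smooth hg α _

theorem classicalD_partialD {g : Rn N → ℝ} (hg : ContDiff ℝ ∞ g) (α : Fin N → ℕ) (i : Fin N) :
    classicalD α (partialD i g) = partialD i (classicalD α g) :=
  foldr_partialD_comm hg α i _

@[simp] theorem classicalD_zero (g : Rn N → ℝ) : classicalD 0 g = g := by
  unfold classicalD
  induction List.finRange N with
  | nil => rfl
  | cons j L ih => simp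

/-- Raising one exponent amounts to one more `∂_i` if `i` occurs in the list, and to nothing
otherwise. -/
theorem foldr_partialD_add_single {g : Rn N → ℝ} (hg : ContDiff ℝ ∞ g) (α : Fin N → ℕ)
    (i : Fin N) (L : List (Fin N)) (hL : L.Nodup) :
    L.foldr (fun j h => (partialD j)^[(α + unitIdx i) j] h) g =
      if i ∈ L then L.foldr (fun j h => (partialD j)^[α j] h) (partialD i g)
      else L.foldr (fun j h => (partialD j)^[α j] h) g := by
  induction L with
  | nil => rfl
  | cons j L ih =>
    rw [List.nodup_cons] at hL
    rw [List.foldr_cons, ih hL.2]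
    by_cases hj : i = j
    · subst hj
      simp only [hL.1, if_false, List.mem_cons, true_or, if_true, List.foldr_cons, Pi.add_apply,
        Pi.single_eq_same]
      rw [Function.iterate_succ_apply, foldr_partialD_comm hg]
    · by_cases hi : i ∈ L <;> simp [hi, hj, Ne.symm hj]

theorem classicalD_add_single {g : Rn N → ℝ} (hg : ContDiff ℝ ∞ g) (α : Fin N → ℕ) (i : Fin N) :
    classicalD (α + unitIdx i) g = classicalD α (partialD i g) := by
  have := foldr_partialD_add_single hg α i (List.finRange N) (List.nodup_finRange N)
  simpa [classicalD] using this

theorem classicalD_add_single' {g : Rn N → ℝ} (hg : ContDiff ℝ ∞ g) (α : Fin N → ℕ)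
    (i : Fin N) : classicalD (α + unitIdx i) g = partialD i (classicalD α g) := by
  rw [classicalD_add_single hg, classicalD_partialD hg]

theorem classicalD_add {g : Rn N → ℝ} (hg : ContDiff ℝ ∞ g) (α β : Fin N → ℕ) :
    classicalD (α + β) g = classicalD α (classicalD β g) := by
  induction β using multiIdx_induction generalizing g with
  | zero => simp
  | add_single β i ih =>
    rw [← add_assoc, classicalD_add_single hg, ih (partialD_smooth hg i),
      classicalD_add_single hg]

theorem classicalD_comm {g : Rn N → ℝ} (hg : ContDiff ℝ ∞ g) (α β : Fin N → ℕ) :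
    classicalD α (classicalD β g) = classicalD β (classicalD α g) := by
  rw [← classicalD_add hg, add_comm, classicalD_add hg]

theorem partialD_add {f g : Rn N → ℝ} (hf : ContDiff ℝ ∞ f) (hg : ContDiff ℝ ∞ g) (i : Fin N) :
    partialD i (f + g) = partialD i f + partialD i g := by
  ext x
  simp only [partialD, Pi.add_apply]
  rw [fderiv_add (hf.differentiable (by simp) x) (hg.differentiable (by simp) x)]
  rfl

theorem classicalD_fun_add {f g : Rn N → ℝ} (hf : ContDiff ℝ ∞ f) (hg : ContDiff ℝ ∞ g)
    (α : Fin N → ℕ) : classicalD α (f + g) = classicalD α f + classicalD α g := by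
  induction α using multiIdx_induction generalizing f g with
  | zero => simp
  | add_single α i ih =>
    have : ContDiff ℝ ∞ (f + g) := hf.add hg
    rw [classicalD_add_single this, classicalD_add_single hf, classicalD_add_single hg,
      partialD_add hf hg, ih (partialD_smooth hf i) (partialD_smooth hg i)]

theorem partialD_mul {f g : Rn N → ℝ} (hf : ContDiff ℝ ∞ f) (hg : ContDiff ℝ ∞ g) (i : Fin N) :
    partialD i (f * g) = partialD i f * g + f * partialD i g := by
  ext x
  simp only [partialD, Pi.add_apply, Pi.mul_apply]
  rw [fderiv_mul (hf.differentiable (by simp) x) (hg.differentiable (by simp) x)]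
  simp
  ring

/-- Locality of `∂^α`. -/
theorem classicalD_congr {f g : Rn N → ℝ} (hf : ContDiff ℝ ∞ f) (hg : ContDiff ℝ ∞ g)
    {U : Set (Rn N)} (hU : IsOpen U) (h : Set.EqOn f g U) (α : Fin N → ℕ) :
    Set.EqOn (classicalD α f) (classicalD α g) U := by
  induction α using multiIdx_induction generalizing f g with
  | zero => simpa using h
  | add_single α i ih =>
    rw [classicalD_add_single hf, classicalD_add_single hg]
    refine ih (partialD_smooth hf i) (partialD_smooth hg i) fun x hx => ?_
    have : f =ᶠ[nhds x] g := Filter.eventually_of_mem (hU.mem_nhds hx) h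
    simp only [partialD, this.fderiv_eq]

theorem tsupport_partialD_subset (g : Rn N → ℝ) (i : Fin N) :
    tsupport (partialD i g) ⊆ tsupport g := by
  refine (closure_minimal ?_ isClosed_closure)
  intro x hx
  refine support_fderiv_subset ℝ (f := g) ?_
  intro h
  exact hx (by simp [partialD, h])

theorem tsupport_classicalD_subset {g : Rn N → ℝ} (hg : ContDiff ℝ ∞ g) (α : Fin N → ℕ) :
    tsupport (classicalD α g) ⊆ tsupport g := by
  induction α using multiIdx_induction generalizing g with
  | zero => simp
  | add_single α i ih =>
    rw [classicalD_add_single hg]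
    exact (ih (partialD_smooth hg i)).trans (tsupport_partialD_subset g i)

theorem IsTestFunction.mono_tsupport {Ω : Set (Rn N)} {ψ φ : Rn N → ℝ} (hψ : IsTestFunction Ω ψ)
    (hφ : ContDiff ℝ ∞ φ) (h : tsupport φ ⊆ tsupport ψ) : IsTestFunction Ω φ :=
  ⟨hφ, hψ.hasCompactSupport.of_isClosed_subset (isClosed_tsupport _) h,
    h.trans hψ.tsupport_subset⟩

theorem IsTestFunction.partialD {Ω : Set (Rn N)} {ψ : Rn N → ℝ} (hψ : IsTestFunction Ω ψ)
    (i : Fin N) : IsTestFunction Ω (partialD i ψ) :=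
  hψ.mono_tsupport (partialD_smooth hψ.contDiff i) (tsupport_partialD_subset ψ i)

theorem IsTestFunction.classicalD {Ω : Set (Rn N)} {ψ : Rn N → ℝ} (hψ : IsTestFunction Ω ψ)
    (α : Fin N → ℕ) : IsTestFunction Ω (classicalD α ψ) :=
  hψ.mono_tsupport (classicalD_smooth hψ.contDiff α) (tsupport_classicalD_subset hψ.contDiff α)

theorem IsTestFunction.mul_smooth {Ω : Set (Rn N)} {ψ w : Rn N → ℝ} (hψ : IsTestFunction Ω ψ)
    (hw : ContDiff ℝ ∞ w) : IsTestFunction Ω (ψ * w) :=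
  hψ.mono_tsupport (hψ.contDiff.mul hw) (tsupport_mul_subset_left (f := ψ) (g := w))

theorem IsTestFunction.sub {Ω : Set (Rn N)} {ψ φ : Rn N → ℝ} (hψ : IsTestFunction Ω ψ)
    (hφ : IsTestFunction Ω φ) : IsTestFunction Ω (ψ - φ) :=
  ⟨hψ.contDiff.sub hφ.contDiff, hψ.hasCompactSupport.sub hφ.hasCompactSupport,
    (tsupport_sub ψ φ).trans (Set.union_subset hψ.tsupport_subset hφ.tsupport_subset)⟩

theorem IsTestFunction.mono {Ω Ω' : Set (Rn N)} {ψ : Rn N → ℝ} (hψ : IsTestFunction Ω ψ)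
    (h : Ω ⊆ Ω') : IsTestFunction Ω' ψ :=
  ⟨hψ.contDiff, hψ.hasCompactSupport, hψ.tsupport_subset.trans h⟩

theorem integral_mul_partialD {Ω : Set (Rn N)} {g ψ : Rn N → ℝ} (hg : ContDiff ℝ ∞ g)
    (hψ : IsTestFunction Ω ψ) (i : Fin N) :
    ∫ x, g x * partialD i ψ x = -∫ x, partialD i g x * ψ x := by
  refine integral_mul_fderiv_eq_neg_fderiv_mul_of_integrable ?_ ?_ ?_ ?_ ?_
  · have hc := (partialD_smooth hg i).continuous.mul hψ.contDiff.continuous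
    exact hc.integrable_of_hasCompactSupport hψ.hasCompactSupport.mul_left
  · exact (hg.continuous.mul (hψ.partialD i).contDiff.continuous).integrable_of_hasCompactSupport
      ((hψ.partialD i).hasCompactSupport.mul_left)
  · exact (hg.continuous.mul hψ.contDiff.continuous).integrable_of_hasCompactSupport
      (hψ.hasCompactSupport.mul_left)
  · exact fun x _ => hg.differentiable (by simp) x
  · exact fun x _ => hψ.contDiff.differentiable (by simp) x

theorem integral_mul_classicalD {Ω : Set (Rn N)} {g ψ : Rn N → ℝ} (hg : ContDiff ℝ ∞ g)
    (hψ : IsTestFunction Ω ψ) (α : Fin N → ℕ) :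
    ∫ x, g x * classicalD α ψ x = (-1) ^ (∑ i, α i) * ∫ x, classicalD α g x * ψ x := by
  induction α using multiIdx_induction generalizing g ψ with
  | zero => simp
  | add_single α i ih =>
    rw [classicalD_add_single' hψ.contDiff, integral_mul_partialD hg (hψ.classicalD α),
      ih (partialD_smooth hg i) hψ, classicalD_add_single hg, sum_add_single]
    ring

/-- The chain rule for the reflections `y ↦ x - y`. -/
theorem classicalD_comp_sub {g : Rn N → ℝ} (hg : ContDiff ℝ ∞ g) (α : Fin N → ℕ) (x : Rn N) :
    classicalD α (fun y => g (x - y)) =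
      fun y => (-1) ^ (∑ i, α i) * classicalD α g (x - y) := by
  have hsm : ∀ {h : Rn N → ℝ}, ContDiff ℝ ∞ h → ContDiff ℝ ∞ fun y => h (x - y) := fun hh =>
    hh.comp (contDiff_const.sub contDiff_id)
  induction α using multiIdx_induction generalizing g with
  | zero => simp
  | add_single α i ih =>
    rw [classicalD_add_single' (hsm hg), ih hg, classicalD_add_single' hg, sum_add_single]
    ext y
    have hd : DifferentiableAt ℝ (classicalD α g) (x - y) :=
      (classicalD_smooth hg α).differentiable (by simp) _
    have h1 : HasFDerivAt (fun y : Rn N => x - y) (-ContinuousLinearMap.id ℝ (Rn N)) y := by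
      simpa using (hasFDerivAt_id y).const_sub x
    have h2 := (hd.hasFDerivAt.comp y h1).const_mul ((-1 : ℝ) ^ (∑ i, α i))
    simp only [InteriorReg.partialD]
    have h3 := h2.fderiv
    simp only [Function.comp_def] at h3
    rw [h3]
    simp [pow_succ]

/-! ### `L²` bounds for products and commutators with cut-off functions -/

/-- All derivatives `∂^α w` of order `|α| < k` are bounded by `K` in `L²(Ω)`. The strict
inequality makes `k = 0` the empty condition; a bound in `H^m(Ω)` is the case `k = m + 1`. -/
def DerivBound (k : ℕ) (Ω : Set (Rn N)) (w : Rn N → ℝ) (K : ℝ) : Prop :=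
  ∀ α : Fin N → ℕ, ∑ i, α i < k →
    eLpNorm (classicalD α w) 2 (volume.restrict Ω) ≤ ENNReal.ofReal K

theorem DerivBound.mono {k k' : ℕ} {Ω Ω' : Set (Rn N)} {w : Rn N → ℝ} {K K' : ℝ}
    (h : DerivBound k Ω w K) (hk : k' ≤ k) (hΩ : Ω' ⊆ Ω) (hK : K ≤ K') :
    DerivBound k' Ω' w K' := fun α hα =>
  (eLpNorm_mono_measure _ (Measure.restrict_mono hΩ le_rfl)).trans
    ((h α (hα.trans_le hk)).trans (ENNReal.ofReal_le_ofReal hK))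

theorem DerivBound.partialD {k : ℕ} {Ω : Set (Rn N)} {w : Rn N → ℝ} {K : ℝ}
    (h : DerivBound (k + 1) Ω w K) (hw : ContDiff ℝ ∞ w) (i : Fin N) :
    DerivBound k Ω (partialD i w) K := fun α hα => by
  rw [← classicalD_add_single hw]
  exact h _ (by rw [sum_add_single]; omega)

theorem DerivBound.classicalD {k n : ℕ} {Ω : Set (Rn N)} {w : Rn N → ℝ} {K : ℝ}
    (h : DerivBound (k + n) Ω w K) (hw : ContDiff ℝ ∞ w) {γ : Fin N → ℕ} (hγ : ∑ i, γ i ≤ n) :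
    DerivBound k Ω (classicalD γ w) K := fun α hα => by
  rw [← classicalD_add hw]
  refine h _ ?_
  simp only [Pi.add_apply, Finset.sum_add_distrib]
  omega

theorem eLpNorm_add_le_ofReal {μ : Measure (Rn N)} {f g : Rn N → ℝ} {A B : ℝ}
    (hf : AEStronglyMeasurable f μ) (hg : AEStronglyMeasurable g μ) (hA : 0 ≤ A) (hB : 0 ≤ B)
    (h1 : eLpNorm f 2 μ ≤ ENNReal.ofReal A) (h2 : eLpNorm g 2 μ ≤ ENNReal.ofReal B) :
    eLpNorm (f + g) 2 μ ≤ ENNReal.ofReal (A + B) := by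
  rw [ENNReal.ofReal_add hA hB]
  exact (eLpNorm_add_le hf hg (by norm_num)).trans (add_le_add h1 h2)

/-- Multiplication by a test function in `Ω` is bounded from `L²(Ω)` to `L²(ℝ^N)`. -/
theorem IsTestFunction.exists_eLpNorm_mul_le {Ω : Set (Rn N)} {ζ : Rn N → ℝ}
    (hζ : IsTestFunction Ω ζ) :
    ∃ C : ℝ, 0 ≤ C ∧ ∀ (w : Rn N → ℝ) (K : ℝ),
      eLpNorm w 2 (volume.restrict Ω) ≤ ENNReal.ofReal K →
      eLpNorm (ζ * w) 2 volume ≤ ENNReal.ofReal (C * K) := by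
  obtain ⟨C, hC⟩ := hζ.hasCompactSupport.exists_bound_of_continuous hζ.contDiff.continuous
  have hC0 : 0 ≤ C := (norm_nonneg _).trans (hC 0)
  refine ⟨C, hC0, fun w K hK => ?_⟩
  have hs : Function.support (ζ * w) ⊆ Ω := fun x hx =>
    hζ.tsupport_subset (subset_tsupport _ fun h => hx (by simp [h]))
  rw [← eLpNorm_restrict_eq_of_support_subset hs, ENNReal.ofReal_mul hC0]
  refine (eLpNorm_le_mul_eLpNorm_of_ae_le_mul (g := w) (c := C)
    (Filter.Eventually.of_forall fun x => ?_) 2).trans (by gcongr)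
  simp only [Pi.mul_apply, norm_mul]
  exact mul_le_mul_of_nonneg_right (hC x) (norm_nonneg _)

theorem smooth_aesm {f : Rn N → ℝ} (hf : ContDiff ℝ ∞ f) (μ : Measure (Rn N)) :
    AEStronglyMeasurable f μ :=
  hf.continuous.aestronglyMeasurable

/-- Multiplication by a test function in `Ω` is bounded in the Sobolev norms. -/
theorem exists_derivBound_mul {Ω : Set (Rn N)} (k : ℕ) {ζ : Rn N → ℝ}
    (hζ : IsTestFunction Ω ζ) :
    ∃ C : ℝ, 0 ≤ C ∧ ∀ (w : Rn N → ℝ) (K : ℝ), ContDiff ℝ ∞ w → 0 ≤ K →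
      DerivBound k Ω w K → DerivBound k Set.univ (ζ * w) (C * K) := by
  induction k generalizing ζ with
  | zero => exact ⟨0, le_rfl, fun w K _ _ _ α hα => absurd hα (Nat.not_lt_zero _)⟩
  | succ k ih =>
    obtain ⟨C₀, hC₀, h₀⟩ := hζ.exists_eLpNorm_mul_le
    obtain ⟨C₁, hC₁, h₁⟩ := ih hζ
    choose C hC h using fun i => ih (hζ.partialD i)
    have hsum : 0 ≤ ∑ i, C i := Finset.sum_nonneg fun i _ => hC i
    refine ⟨C₀ + (∑ i, C i + C₁), by positivity, fun w K hw hK hb α hα => ?_⟩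
    rcases Nat.eq_zero_or_pos (∑ i, α i) with h0 | hpos
    · obtain rfl : α = 0 := by
        ext i
        exact Finset.sum_eq_zero_iff.mp h0 i (Finset.mem_univ i)
      rw [classicalD_zero, Measure.restrict_univ]
      refine (h₀ w K (by simpa using hb 0 (by simp))).trans (ENNReal.ofReal_le_ofReal ?_)
      gcongr
      linarith
    · obtain ⟨α', i, rfl, hα'⟩ := exists_eq_add_single (n := ∑ i, α i - 1) (by omega : ∑ i, α i = _)
      rw [sum_add_single] at hα
      have hζs := hζ.contDiff
      have s0 : ContDiff ℝ ∞ (ζ * w) := hζs.mul hw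
      have s1 : ContDiff ℝ ∞ (partialD i ζ * w) := (partialD_smooth hζs i).mul hw
      have s2 : ContDiff ℝ ∞ (ζ * partialD i w) := hζs.mul (partialD_smooth hw i)
      rw [classicalD_add_single s0, partialD_mul hζs hw, classicalD_fun_add s1 s2]
      refine (eLpNorm_add_le_ofReal (A := (∑ i, C i) * K) (B := C₁ * K)
        (smooth_aesm (classicalD_smooth s1 _) _) (smooth_aesm (classicalD_smooth s2 _) _)
        (by positivity) (by positivity) ?_ ?_).trans (ENNReal.ofReal_le_ofReal ?_)
      · refine (h i w K hw hK (hb.mono (by omega) subset_rfl le_rfl) α' (by omega)).trans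
          (ENNReal.ofReal_le_ofReal ?_)
        gcongr
        exact Finset.single_le_sum (fun j _ => hC j) (Finset.mem_univ i)
      · exact h₁ _ K (partialD_smooth hw i) hK (hb.partialD hw i) α' (by omega)
      · nlinarith [mul_nonneg hC₀ hK]

/-- The commutator of `∂^α` and multiplication by a test function has order `|α| - 1`. -/
theorem exists_commutator_bound {Ω : Set (Rn N)} (k : ℕ) {ζ : Rn N → ℝ}
    (hζ : IsTestFunction Ω ζ) :
    ∃ C : ℝ, 0 ≤ C ∧ ∀ (w : Rn N → ℝ) (K : ℝ), ContDiff ℝ ∞ w → 0 ≤ K →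
      DerivBound k Ω w K → ∀ α : Fin N → ℕ, ∑ i, α i ≤ k →
      eLpNorm (classicalD α (ζ * w) - ζ * classicalD α w) 2 volume ≤ ENNReal.ofReal (C * K) := by
  induction k with
  | zero =>
    refine ⟨0, le_rfl, fun w K _ _ _ α hα => ?_⟩
    obtain rfl : α = 0 := by
      ext i
      exact Finset.sum_eq_zero_iff.mp (Nat.le_zero.mp hα) i (Finset.mem_univ i)
    simp
  | succ k ih =>
    obtain ⟨C₁, hC₁, h₁⟩ := ih
    choose C hC h using fun i => exists_derivBound_mul (k + 1) (hζ.partialD i)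
    have hsum : 0 ≤ ∑ i, C i := Finset.sum_nonneg fun i _ => hC i
    refine ⟨∑ i, C i + C₁, by positivity, fun w K hw hK hb α hα => ?_⟩
    rcases Nat.eq_zero_or_pos (∑ i, α i) with h0 | hpos
    · obtain rfl : α = 0 := by
        ext i
        exact Finset.sum_eq_zero_iff.mp h0 i (Finset.mem_univ i)
      simp
    · obtain ⟨α', i, rfl, hα'⟩ := exists_eq_add_single (n := ∑ i, α i - 1) (by omega : ∑ i, α i = _)
      rw [sum_add_single] at hα
      have hζs := hζ.contDiff
      have s0 : ContDiff ℝ ∞ (ζ * w) := hζs.mul hw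
      have s1 : ContDiff ℝ ∞ (partialD i ζ * w) := (partialD_smooth hζs i).mul hw
      have s2 : ContDiff ℝ ∞ (ζ * partialD i w) := hζs.mul (partialD_smooth hw i)
      rw [classicalD_add_single s0, classicalD_add_single hw, partialD_mul hζs hw,
        classicalD_fun_add s1 s2, add_sub_assoc, add_mul]
      refine eLpNorm_add_le_ofReal (smooth_aesm (classicalD_smooth s1 _) _) (smooth_aesm
        ((classicalD_smooth s2 _).sub (hζs.mul (classicalD_smooth (partialD_smooth hw i) _))) _)
        (by positivity) (by positivity) ?_ ?_
      · have := h i w K hw hK hb α' (by omega)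
        rw [Measure.restrict_univ] at this
        refine this.trans (ENNReal.ofReal_le_ofReal ?_)
        gcongr
        exact Finset.single_le_sum (fun j _ => hC j) (Finset.mem_univ i)
      · exact h₁ _ K (partialD_smooth hw i) hK (hb.partialD hw i) α' (by omega)

theorem eLpNorm_two_eq {μ : Measure (Rn N)} {f : Rn N → ℝ} (hf : MemLp f 2 μ) :
    eLpNorm f 2 μ = ENNReal.ofReal (Real.sqrt (∫ x, f x ^ 2 ∂μ)) := by
  rw [hf.eLpNorm_eq_integral_rpow_norm (by norm_num) (by norm_num), Real.sqrt_eq_rpow]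
  congr 2
  · simp
  · norm_num

/-- The Cauchy–Schwarz inequality. -/
theorem abs_integral_mul_le {μ : Measure (Rn N)} {f g : Rn N → ℝ} {A B : ℝ}
    (hf : AEStronglyMeasurable f μ) (hg : AEStronglyMeasurable g μ) (hA : 0 ≤ A) (hB : 0 ≤ B)
    (h1 : eLpNorm f 2 μ ≤ ENNReal.ofReal A) (h2 : eLpNorm g 2 μ ≤ ENNReal.ofReal B) :
    |∫ x, f x * g x ∂μ| ≤ A * B := by
  have h3 : eLpNorm (f • g) 1 μ ≤ ENNReal.ofReal (A * B) := by
    rw [ENNReal.ofReal_mul hA]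
    exact (eLpNorm_smul_le_mul_eLpNorm (p := 2) (q := 2) hg hf).trans (mul_le_mul' h1 h2)
  have h4 : ‖∫ x, f x * g x ∂μ‖ₑ ≤ ENNReal.ofReal (A * B) := by
    refine (enorm_integral_le_lintegral_enorm _).trans ?_
    rw [← eLpNorm_one_eq_lintegral_enorm]
    exact h3
  rw [← Real.norm_eq_abs, ← ENNReal.ofReal_le_ofReal_iff (by positivity), ofReal_norm]
  exact h4

/-! ### The Caccioppoli inequality and the a priori estimate for smooth solutions -/

theorem IsTestFunction.integrable_mul {Ω : Set (Rn N)} {g ψ : Rn N → ℝ} (hψ : IsTestFunction Ω ψ)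
    (hg : ContDiff ℝ ∞ g) : Integrable (fun x => g x * ψ x) :=
  (hg.continuous.mul hψ.contDiff.continuous).integrable_of_hasCompactSupport
    hψ.hasCompactSupport.mul_left

theorem IsTestFunction.eq_zero_of_notMem {Ω : Set (Rn N)} {ψ : Rn N → ℝ}
    (hψ : IsTestFunction Ω ψ) {x : Rn N} (hx : x ∉ Ω) : ψ x = 0 :=
  image_eq_zero_of_notMem_tsupport fun h => hx (hψ.tsupport_subset h)

theorem IsTestFunction.setIntegral_mul {Ω : Set (Rn N)} {ψ : Rn N → ℝ}
    (hψ : IsTestFunction Ω ψ) (g : Rn N → ℝ) : ∫ x in Ω, g x * ψ x = ∫ x, g x * ψ x :=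
  setIntegral_eq_integral_of_forall_compl_eq_zero fun x hx => by
    rw [hψ.eq_zero_of_notMem hx, mul_zero]

/-- The ellipticity condition holds pointwise for the vector `(∂^α v(x))_α`, so it may simply be
integrated; no Fourier transform is needed. -/
theorem sum_integral_sq_le_of_isElliptic {Ω : Set (Rn N)} {m : ℕ} {lam : ℝ} {a : Coeff N}
    (ha : IsEllipticWith m lam a) {v : Rn N → ℝ} (hv : IsTestFunction Ω v) :
    lam * ∑ α ∈ multiIdx N m, ∫ x, classicalD α v x * classicalD α v x ≤
      ∑ α ∈ multiIdx N m, ∑ β ∈ multiIdx N m,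
        a α β * ∫ x, classicalD α v x * classicalD β v x := by
  have hi : ∀ α β, Integrable (fun x => classicalD α v x * classicalD β v x) := fun α β =>
    (hv.classicalD β).integrable_mul (hv.classicalD α).contDiff
  have h1 : lam * ∑ α ∈ multiIdx N m, ∫ x, classicalD α v x * classicalD α v x =
      ∫ x, lam * ∑ α ∈ multiIdx N m, |classicalD α v x| ^ 2 := by
    rw [integral_const_mul, ← integral_finsetSum _ fun α _ => hi α α]
    simp only [sq_abs, ← sq]
  have h2 : ∑ α ∈ multiIdx N m, ∑ β ∈ multiIdx N m,
        a α β * ∫ x, classicalD α v x * classicalD β v x =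
      ∫ x, ∑ α ∈ multiIdx N m, ∑ β ∈ multiIdx N m,
        a α β * classicalD α v x * classicalD β v x := by
    rw [integral_finsetSum]
    · refine Finset.sum_congr rfl fun α _ => ?_
      rw [integral_finsetSum]
      · refine Finset.sum_congr rfl fun β _ => ?_
        rw [← integral_const_mul]
        simp only [mul_assoc]
      · intro β _
        simpa only [mul_assoc] using (hi α β).const_mul (a α β)
    · intro α _
      refine integrable_finsetSum _ fun β _ => ?_
      simpa only [mul_assoc] using (hi α β).const_mul (a α β)
  rw [h1, h2]
  refine integral_mono ?_ ?_ fun x => ha fun α => classicalD α v x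
  · refine (integrable_finsetSum _ fun α _ => ?_).const_mul lam
    simpa only [abs_mul_abs_self, sq] using hi α α
  · refine integrable_finsetSum _ fun α _ => integrable_finsetSum _ fun β _ => ?_
    simpa only [mul_assoc] using (hi α β).const_mul (a α β)

/-- The term `∫ ∂^α w · S_β` with the commutator `S_β = ∂^β (η v) - η ∂^β v`: moving one derivative
from `w` to `S_β` leaves a derivative of `w` of order `m - 1` only. -/
theorem exists_integral_commutator_bound {Ω : Set (Rn N)} {m : ℕ} (hm : 1 ≤ m) {η : Rn N → ℝ}
    (hη : IsTestFunction Ω η) :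
    ∃ C : ℝ, 0 ≤ C ∧ ∀ (w v : Rn N → ℝ) (K K' : ℝ), ContDiff ℝ ∞ w → ContDiff ℝ ∞ v → 0 ≤ K →
      0 ≤ K' → DerivBound m Ω w K → DerivBound (m + 1) Ω v K' →
      ∀ α ∈ multiIdx N m, ∀ β ∈ multiIdx N m,
        |∫ x, classicalD α w x * (classicalD β (η * v) - η * classicalD β v) x| ≤
          C * (K * K') := by
  obtain ⟨C₁, hC₁, h₁⟩ := exists_commutator_bound (m + 1) hη
  choose C hC h using fun i => (hη.partialD i).exists_eLpNorm_mul_le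
  have hsum : 0 ≤ ∑ i, C i := Finset.sum_nonneg fun i _ => hC i
  refine ⟨C₁ + ∑ i, C i, by positivity, fun w v K K' hw hv hK hK' hbw hbv α hα β hβ => ?_⟩
  rw [mem_multiIdx] at hα hβ
  obtain ⟨α', i, rfl, hα'⟩ := exists_eq_add_single (n := m - 1) (by omega : ∑ i, α i = _)
  have hηv : IsTestFunction Ω (η * v) := hη.mul_smooth hv
  have hS : IsTestFunction Ω (classicalD β (η * v) - η * classicalD β v) :=
    (hηv.classicalD β).sub (hη.mul_smooth (classicalD_smooth hv β))
  have hSi : partialD i (classicalD β (η * v) - η * classicalD β v) =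
      (classicalD (β + unitIdx i) (η * v) - η * classicalD (β + unitIdx i) v) +
        -(partialD i η * classicalD β v) := by
    have hp : ContDiff ℝ ∞ (η * classicalD β v) := hη.contDiff.mul (classicalD_smooth hv β)
    have e : partialD i (classicalD β (η * v) - η * classicalD β v) +
        partialD i (η * classicalD β v) = partialD i (classicalD β (η * v)) := by
      rw [← partialD_add hS.contDiff hp, sub_add_cancel]
    rw [partialD_mul hη.contDiff (classicalD_smooth hv β)] at e
    rw [classicalD_add_single' hηv.contDiff, classicalD_add_single' hv, ← e]
    abel
  have hnorm : eLpNorm (partialD i (classicalD β (η * v) - η * classicalD β v)) 2 volume ≤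
      ENNReal.ofReal ((C₁ + ∑ i, C i) * K') := by
    rw [hSi, add_mul]
    have s1 : ContDiff ℝ ∞
        (classicalD (β + unitIdx i) (η * v) - η * classicalD (β + unitIdx i) v) :=
      (classicalD_smooth hηv.contDiff _).sub (hη.contDiff.mul (classicalD_smooth hv _))
    have s2 : ContDiff ℝ ∞ (-(partialD i η * classicalD β v)) :=
      ((partialD_smooth hη.contDiff i).mul (classicalD_smooth hv _)).neg
    refine eLpNorm_add_le_ofReal (smooth_aesm s1 _) (smooth_aesm s2 _) (by positivity)
      (by positivity) ?_ ?_
    · exact h₁ v K' hv hK' hbv _ (by rw [sum_add_single]; omega)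
    · rw [eLpNorm_neg]
      refine (h i _ K' (hbv β (by omega))).trans (ENNReal.ofReal_le_ofReal ?_)
      gcongr
      exact Finset.single_le_sum (fun j _ => hC j) (Finset.mem_univ i)
  have hparts := integral_mul_partialD (classicalD_smooth hw α') hS i
  rw [classicalD_add_single' hw, ← abs_neg, ← hparts, ← (hS.partialD i).setIntegral_mul]
  have := abs_integral_mul_le (smooth_aesm (classicalD_smooth hw α') (volume.restrict Ω))
    (smooth_aesm (hS.partialD i).contDiff (volume.restrict Ω)) hK
    (by positivity : 0 ≤ (C₁ + ∑ i, C i) * K') (hbw α' (by omega))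
    ((eLpNorm_mono_measure _ Measure.restrict_le_self).trans hnorm)
  refine this.trans (le_of_eq (by ring))

/-- The energy identity behind the Caccioppoli inequality: with `v = η w`, commuting `η` with `∂^α`
and `∂^β` gives the integrand of the weak equation at the test function `η v = η² w`, up to two
commutator terms. -/
theorem integral_energy_eq {Ω : Set (Rn N)} {η w : Rn N → ℝ} (hη : IsTestFunction Ω η)
    (hw : ContDiff ℝ ∞ w) (α β : Fin N → ℕ) :
    ∫ x, classicalD α (η * w) x * classicalD β (η * w) x =
      (∫ x, classicalD α w x * classicalD β (η * (η * w)) x) +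
        (-(∫ x, classicalD α w x *
            (classicalD β (η * (η * w)) - η * classicalD β (η * w)) x) +
          ∫ x, (classicalD α (η * w) - η * classicalD α w) x * classicalD β (η * w) x) := by
  have hv : IsTestFunction Ω (η * w) := hη.mul_smooth hw
  have hηv : IsTestFunction Ω (η * (η * w)) := hη.mul_smooth hv.contDiff
  have i1 : Integrable fun x => classicalD α w x * classicalD β (η * (η * w)) x :=
    (hηv.classicalD β).integrable_mul (classicalD_smooth hw α)
  have i2 : Integrable fun x =>
      classicalD α w x * (classicalD β (η * (η * w)) - η * classicalD β (η * w)) x :=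
    ((hηv.classicalD β).sub (hη.mul_smooth (hv.classicalD β).contDiff)).integrable_mul
      (classicalD_smooth hw α)
  have i3 : Integrable fun x =>
      (classicalD α (η * w) - η * classicalD α w) x * classicalD β (η * w) x :=
    (hv.classicalD β).integrable_mul
      ((hv.classicalD α).contDiff.sub (hη.contDiff.mul (classicalD_smooth hw α)))
  rw [neg_add_eq_sub, ← integral_sub i3 i2]
  refine Eq.trans (integral_congr_ae (Filter.Eventually.of_forall fun x => ?_))
    (integral_add i1 (i3.sub i2))
  simp only [Pi.sub_apply, Pi.mul_apply]
  ring

/-- A quantity whose square is bounded by an affine function of it is bounded. -/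
theorem le_mul_of_mul_sq_le {lam c K X : ℝ} (hlam : 0 < lam) (hc : 0 ≤ c) (hK : 0 ≤ K)
    (hX : 0 ≤ X) (h : lam * X ^ 2 ≤ c * (K * (K + X))) : X ≤ (1 + 2 * c / lam) * K := by
  have h0 : 0 ≤ 2 * c / lam * K := by positivity
  rcases le_total X K with hle | hle
  · linarith
  · rcases hX.eq_or_lt with hz | hlt
    · rw [← hz]
      positivity
    · have h1 : lam * X ≤ 2 * c * K := by
        refine le_of_mul_le_mul_right ?_ hlt
        nlinarith [mul_nonneg (mul_nonneg hc hK) (sub_nonneg.mpr hle)]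
      have h2 : X ≤ 2 * c / lam * K := by
        rw [div_mul_eq_mul_div, le_div_iff₀ hlam]
        linarith
      linarith

/-- **Caccioppoli inequality.** Let `η` be a cut-off function, supported in `Ω` and equal to `1` in
`Ω'`. If the functional `φ ↦ ∑ a_{α,β} ∫ ∂^α w ∂^β φ` is bounded by `K` on test functions in `Ω`
with respect to the `H^m` norm, then the derivatives of `w` of order `m` in `Ω'` are controlled by
`K` and the derivatives of lower order in `Ω`. -/
theorem exists_caccioppoli_bound {Ω Ω' : Set (Rn N)} (hΩ' : IsOpen Ω') {m : ℕ} (hm : 1 ≤ m)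
    (M : ℝ) {lam : ℝ} (hlam : 0 < lam) {η : Rn N → ℝ} (hη : IsTestFunction Ω η)
    (hη1 : ∀ x ∈ Ω', η x = 1) :
    ∃ C : ℝ, 0 ≤ C ∧ ∀ a : Coeff N, IsEllipticWith m lam a →
      (∀ α ∈ multiIdx N m, ∀ β ∈ multiIdx N m, |a α β| ≤ M) →
      ∀ (w : Rn N → ℝ) (K : ℝ), ContDiff ℝ ∞ w → 0 ≤ K → DerivBound m Ω w K →
      (∀ (φ : Rn N → ℝ) (K' : ℝ), IsTestFunction Ω φ → 0 ≤ K' →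
        DerivBound (m + 1) Set.univ φ K' →
        |∑ α ∈ multiIdx N m, ∑ β ∈ multiIdx N m,
          a α β * ∫ x, classicalD α w x * classicalD β φ x| ≤ K * K') →
      DerivBound (m + 1) Ω' w (C * K) := by
  obtain ⟨C₁, hC₁, h₁⟩ := exists_derivBound_mul m hη
  obtain ⟨C₂, hC₂, h₂⟩ := exists_commutator_bound m hη
  obtain ⟨C₃, hC₃, h₃⟩ := exists_derivBound_mul (m + 1) hη
  obtain ⟨C₄, hC₄, h₄⟩ := exists_integral_commutator_bound hm hη
  set n : ℝ := ((multiIdx N m).card : ℝ) with hn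
  have hn0 : 0 ≤ n := Nat.cast_nonneg _
  set C₅ : ℝ := C₃ * (C₁ + 1) + n * (n * (|M| * (C₄ * (C₁ + 1) + C₂))) with hC₅
  have hC₅0 : 0 ≤ C₅ := by positivity
  refine ⟨1 + 2 * C₅ / lam, by positivity, fun a ha haM w K hw hK hb hL => ?_⟩
  have hΩ : Ω' ⊆ Ω := fun x hx => hη.tsupport_subset (subset_tsupport _ (by simp [hη1 x hx]))
  -- `v` is the localized function, and `X` the `L²` norm of its derivatives of order `m`.
  set v : Rn N → ℝ := η * w with hv
  have hvt : IsTestFunction Ω v := hη.mul_smooth hw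
  set X : ℝ := Real.sqrt (∑ α ∈ multiIdx N m, ∫ x, classicalD α v x * classicalD α v x) with hX
  have hX0 : 0 ≤ X := Real.sqrt_nonneg _
  have hpos : ∀ α, 0 ≤ ∫ x, classicalD α v x * classicalD α v x := fun α =>
    integral_nonneg fun x => mul_self_nonneg _
  have hXsq : X ^ 2 = ∑ α ∈ multiIdx N m, ∫ x, classicalD α v x * classicalD α v x :=
    Real.sq_sqrt (Finset.sum_nonneg fun α _ => hpos α)
  have hvX : ∀ α ∈ multiIdx N m, eLpNorm (classicalD α v) 2 volume ≤ ENNReal.ofReal X := by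
    intro α hα
    rw [eLpNorm_two_eq ((hvt.classicalD α).contDiff.continuous.memLp_of_hasCompactSupport
      (hvt.classicalD α).hasCompactSupport)]
    simp only [sq]
    exact ENNReal.ofReal_le_ofReal (Real.sqrt_le_sqrt
      (Finset.single_le_sum (fun β _ => hpos β) hα))
  have hvb : DerivBound (m + 1) Set.univ v (C₁ * K + X) := by
    intro α hα
    rcases Nat.lt_succ_iff_lt_or_eq.mp hα with hlt | heq
    · exact (h₁ w K hw hK hb α hlt).trans (ENNReal.ofReal_le_ofReal (by linarith))
    · rw [Measure.restrict_univ]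
      exact (hvX α (mem_multiIdx.mpr heq)).trans
        (ENNReal.ofReal_le_ofReal (by nlinarith [mul_nonneg hC₁ hK]))
  have hK1 : 0 ≤ C₁ * K + X := by positivity
  have hvbΩ : DerivBound (m + 1) Ω v (C₁ * K + X) :=
    hvb.mono le_rfl (Set.subset_univ _) le_rfl
  have hηv : IsTestFunction Ω (η * v) := hη.mul_smooth hvt.contDiff
  have hLηv := hL _ _ hηv (by positivity) (h₃ v _ hvt.contDiff hK1 hvbΩ)
  -- Both commutator terms are bounded without the derivatives of `w` of order `m`, except for
  -- those of `v`.
  have herr : ∀ α ∈ multiIdx N m, ∀ β ∈ multiIdx N m,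
      a α β * (-(∫ x, classicalD α w x * (classicalD β (η * v) - η * classicalD β v) x) +
        ∫ x, (classicalD α v - η * classicalD α w) x * classicalD β v x) ≤
      |M| * (C₄ * (K * (C₁ * K + X)) + C₂ * K * X) := by
    intro α hα β hβ
    have e1 := h₄ w v K _ hw hvt.contDiff hK hK1 hb hvbΩ α hα β hβ
    have s : ContDiff ℝ ∞ (classicalD α v - η * classicalD α w) :=
      (hvt.classicalD α).contDiff.sub (hη.contDiff.mul (classicalD_smooth hw α))
    have e2 := abs_integral_mul_le (smooth_aesm s volume)
      (smooth_aesm (hvt.classicalD β).contDiff volume) (by positivity : 0 ≤ C₂ * K) hX0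
      (h₂ w K hw hK hb α (mem_multiIdx.mp hα).le) (hvX β hβ)
    refine (le_abs_self _).trans ?_
    rw [abs_mul]
    refine mul_le_mul ((haM α hα β hβ).trans (le_abs_self M)) ?_ (abs_nonneg _) (abs_nonneg _)
    refine (abs_add_le _ _).trans (add_le_add ?_ e2)
    rwa [abs_neg]
  have hmain : lam * X ^ 2 ≤ C₅ * (K * (K + X)) := by
    have hE := sum_integral_sq_le_of_isElliptic ha hvt
    rw [← hXsq] at hE
    have hdec : ∑ α ∈ multiIdx N m, ∑ β ∈ multiIdx N m,
        a α β * ∫ x, classicalD α v x * classicalD β v x =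
        (∑ α ∈ multiIdx N m, ∑ β ∈ multiIdx N m,
          a α β * ∫ x, classicalD α w x * classicalD β (η * v) x) +
        ∑ α ∈ multiIdx N m, ∑ β ∈ multiIdx N m, a α β *
          (-(∫ x, classicalD α w x * (classicalD β (η * v) - η * classicalD β v) x) +
            ∫ x, (classicalD α v - η * classicalD α w) x * classicalD β v x) := by
      simp only [← Finset.sum_add_distrib]
      refine Finset.sum_congr rfl fun α _ => Finset.sum_congr rfl fun β _ => ?_
      rw [integral_energy_eq hη hw, mul_add]
    have hR : ∑ α ∈ multiIdx N m, ∑ β ∈ multiIdx N m,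
        a α β * (-(∫ x, classicalD α w x * (classicalD β (η * v) - η * classicalD β v) x) +
          ∫ x, (classicalD α v - η * classicalD α w) x * classicalD β v x) ≤
        n * (n * (|M| * (C₄ * (K * (C₁ * K + X)) + C₂ * K * X))) := by
      calc _ ≤ ∑ α ∈ multiIdx N m, ∑ β ∈ multiIdx N m,
            |M| * (C₄ * (K * (C₁ * K + X)) + C₂ * K * X) :=
          Finset.sum_le_sum fun α hα => Finset.sum_le_sum fun β hβ => herr α hα β hβ
        _ = _ := by simp [hn]
    have hC : C₁ * K + X ≤ (C₁ + 1) * (K + X) := by nlinarith [mul_nonneg hC₁ hX0]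
    have hX' : X ≤ K + X := by linarith
    calc lam * X ^ 2 ≤ K * (C₃ * (C₁ * K + X)) +
          n * (n * (|M| * (C₄ * (K * (C₁ * K + X)) + C₂ * K * X))) := by
            have := (le_abs_self _).trans hLηv
            linarith
      _ ≤ K * (C₃ * ((C₁ + 1) * (K + X))) +
          n * (n * (|M| * (C₄ * (K * ((C₁ + 1) * (K + X))) + C₂ * K * (K + X)))) := by gcongr
      _ = C₅ * (K * (K + X)) := by rw [hC₅]; ring
  -- The estimate is quadratic in `X` on the left and linear on the right.
  have hXK : X ≤ (1 + 2 * C₅ / lam) * K := le_mul_of_mul_sq_le hlam hC₅0 hK hX0 hmain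
  intro α hα
  rcases Nat.lt_succ_iff_lt_or_eq.mp hα with hlt | heq
  · refine (hb.mono le_rfl hΩ ?_ : DerivBound m Ω' w _) α hlt
    have h0 : 0 ≤ 2 * C₅ / lam * K := by positivity
    linarith
  · have hEq : Set.EqOn (classicalD α w) (classicalD α v) Ω' :=
      classicalD_congr hw hvt.contDiff hΩ' (fun x hx => by simp [hv, hη1 x hx]) α
    rw [eLpNorm_congr_ae ((ae_restrict_iff' hΩ'.measurableSet).mpr
      (Filter.Eventually.of_forall hEq))]
    exact (eLpNorm_mono_measure _ Measure.restrict_le_self).trans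
      ((hvX α (mem_multiIdx.mpr heq)).trans (ENNReal.ofReal_le_ofReal hXK))

/-- Interior estimate for smooth solutions, by induction on the number `j` of derivatives gained:
each step applies the Caccioppoli inequality to the derivatives `∂^γ u` with `|γ| = j + 1`, which
solve the equation with right-hand side `∂^γ f`; at most `l` of these derivatives are left on `f`
and the others, at most `m`, are moved to the test function. -/
theorem exists_smooth_interior_bound {m : ℕ} (hm : 1 ≤ m) (l : ℕ) (M : ℝ) {lam : ℝ}
    (hlam : 0 < lam) (R : ℝ) (j : ℕ) (hj : j ≤ m + l) :
    ∀ r : ℝ, 0 < r → r < R → ∃ C : ℝ, 0 ≤ C ∧ ∀ a : Coeff N, IsEllipticWith m lam a →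
      (∀ α ∈ multiIdx N m, ∀ β ∈ multiIdx N m, |a α β| ≤ M) →
      ∀ (u f : Rn N → ℝ) (K : ℝ), ContDiff ℝ ∞ u → ContDiff ℝ ∞ f → 0 ≤ K →
      DerivBound (m + 1) (Metric.ball 0 R) u K → DerivBound (l + 1) (Metric.ball 0 R) f K →
      (∀ φ : Rn N → ℝ, IsTestFunction (Metric.ball 0 R) φ →
        ∑ α ∈ multiIdx N m, ∑ β ∈ multiIdx N m,
          a α β * ∫ x, classicalD α u x * classicalD β φ x = ∫ x, f x * φ x) →
      DerivBound (m + j + 1) (Metric.ball 0 r) u (C * K) := by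
  induction j with
  | zero =>
    intro r _ hr
    refine ⟨1, zero_le_one, fun a _ _ u f K _ _ _ hu _ _ => ?_⟩
    exact hu.mono le_rfl (Metric.ball_subset_ball hr.le) (one_mul K).ge
  | succ j ih =>
    intro r hr0 hr
    set ρ : ℝ := (r + R) / 2 with hρ
    have hrρ : r < ρ := by rw [hρ]; linarith
    have hρR : ρ < R := by rw [hρ]; linarith
    obtain ⟨C, hC, hIH⟩ := ih (by omega) ρ (by linarith) hρR
    let η : ContDiffBump (0 : Rn N) := ⟨r, (r + ρ) / 2, hr0, by linarith⟩
    have hη : IsTestFunction (Metric.ball 0 ρ) (η : Rn N → ℝ) :=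
      ⟨η.contDiff, η.hasCompactSupport, by
        rw [η.tsupport_eq]
        exact Metric.closedBall_subset_ball (by change (r + ρ) / 2 < ρ; linarith)⟩
    obtain ⟨C', hC', hcac⟩ := exists_caccioppoli_bound (Ω' := Metric.ball 0 r) Metric.isOpen_ball
      hm M hlam hη fun x hx => η.one_of_mem_closedBall (Metric.ball_subset_closedBall hx)
    refine ⟨C + C' * (C + 1), by positivity, fun a ha haM u f K hu hf hK hbu hbf heq => ?_⟩
    have hprev := hIH a ha haM u f K hu hf hK hbu hbf heq
    have hderiv : ∀ γ : Fin N → ℕ, ∑ i, γ i = j + 1 →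
        DerivBound (m + 1) (Metric.ball 0 r) (classicalD γ u) (C' * ((C + 1) * K)) := by
      intro γ hγ
      refine hcac a ha haM _ _ (classicalD_smooth hu γ) (by positivity) ?_ ?_
      · refine DerivBound.classicalD (n := j + 1) ?_ hu hγ.le
        refine hprev.mono (by omega) subset_rfl ?_
        linarith
      intro φ K' hφ hK' hbφ
      have hφR := hφ.mono (Metric.ball_subset_ball hρR.le)
      obtain ⟨γ₁, γ₂, rfl, hγ₁, hγ₂⟩ :=
        exists_eq_add_of_sum (α := γ) (a := min l (j + 1)) (b := j + 1 - min l (j + 1)) (by omega)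
      -- The signs of all these integrations by parts cancel or are removed by the absolute value.
      have hterm : ∀ α β, ∫ x, classicalD α (classicalD (γ₁ + γ₂) u) x * classicalD β φ x =
          (-1) ^ (∑ i, (γ₁ + γ₂) i) *
            ∫ x, classicalD α u x * classicalD β (classicalD (γ₁ + γ₂) φ) x := by
        intro α β
        rw [classicalD_comm hφ.contDiff, integral_mul_classicalD (classicalD_smooth hu α)
          (hφR.classicalD β), classicalD_comm hu, ← mul_assoc, ← pow_add,
          Even.neg_one_pow ⟨_, rfl⟩, one_mul]
      have hsum : ∑ α ∈ multiIdx N m, ∑ β ∈ multiIdx N m,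
          a α β * ∫ x, classicalD α (classicalD (γ₁ + γ₂) u) x * classicalD β φ x =
          (-1) ^ (∑ i, (γ₁ + γ₂) i) * ∫ x, f x * classicalD (γ₁ + γ₂) φ x := by
        rw [← heq _ (hφR.classicalD _)]
        simp only [hterm, Finset.mul_sum]
        refine Finset.sum_congr rfl fun α _ => Finset.sum_congr rfl fun β _ => ?_
        ring
      rw [hsum, abs_mul, abs_pow, abs_neg, abs_one, one_pow, one_mul, classicalD_add hφ.contDiff,
        integral_mul_classicalD hf (hφR.classicalD γ₂), abs_mul, abs_pow, abs_neg, abs_one,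
        one_pow, one_mul, ← (hφR.classicalD γ₂).setIntegral_mul]
      refine abs_integral_mul_le (smooth_aesm (classicalD_smooth hf _) _)
        (smooth_aesm (hφ.classicalD _).contDiff _) (by positivity) hK' ?_ ?_
      · refine (hbf γ₁ (by omega)).trans (ENNReal.ofReal_le_ofReal ?_)
        nlinarith [mul_nonneg hC hK]
      · exact hbφ.mono le_rfl (Set.subset_univ _) le_rfl γ₂ (by omega)
    intro α hα
    have hCK : 0 ≤ C * K := by positivity
    have hCK' : 0 ≤ C' * ((C + 1) * K) := by positivity
    rcases Nat.lt_succ_iff_lt_or_eq.mp hα with hlt | heq'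
    · refine (hprev.mono le_rfl (Metric.ball_subset_ball hrρ.le) ?_ :
        DerivBound (m + j + 1) (Metric.ball 0 r) u _) α (by omega)
      linarith
    · obtain ⟨α₁, γ, rfl, hα₁, hγ⟩ := exists_eq_add_of_sum (a := m) (b := j + 1) heq'
      rw [classicalD_add hu]
      exact (hderiv γ hγ α₁ (by omega)).trans (ENNReal.ofReal_le_ofReal (by linarith))

/-! ### Mollification -/

/-- The convolution `g * k`, written so that all derivatives fall on the kernel `k`. -/
def mollify (k g : Rn N → ℝ) : Rn N → ℝ := fun x => ∫ t, g t * k (x - t)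

theorem mollify_eq_convolution (k g : Rn N → ℝ) :
    mollify k g = convolution g k (ContinuousLinearMap.mul ℝ ℝ) volume := rfl

theorem mollify_smooth {Ω : Set (Rn N)} {k g : Rn N → ℝ} (hk : IsTestFunction Ω k)
    (hg : LocallyIntegrable g) : ContDiff ℝ ∞ (mollify k g) :=
  hk.hasCompactSupport.contDiff_convolution_right (n := ⊤)
    (ContinuousLinearMap.mul ℝ ℝ) hg hk.contDiff

theorem partialD_mollify {Ω : Set (Rn N)} {k g : Rn N → ℝ} (hk : IsTestFunction Ω k)
    (hg : LocallyIntegrable g) (i : Fin N) :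
    partialD i (mollify k g) = mollify (partialD i k) g := by
  ext x
  have h := hk.hasCompactSupport.hasFDerivAt_convolution_right (ContinuousLinearMap.mul ℝ ℝ) hg
    (hk.contDiff.of_le (by simp)) x
  rw [partialD, mollify_eq_convolution, h.fderiv, convolution_precompR_apply _ hg
    (hk.hasCompactSupport.fderiv ℝ) (hk.contDiff.continuous_fderiv (by simp))]
  rfl

theorem classicalD_mollify {Ω : Set (Rn N)} {k g : Rn N → ℝ} (hk : IsTestFunction Ω k)
    (hg : LocallyIntegrable g) (α : Fin N → ℕ) :
    classicalD α (mollify k g) = mollify (classicalD α k) g := by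
  induction α using multiIdx_induction generalizing k with
  | zero => simp
  | add_single α i ih =>
    rw [classicalD_add_single (mollify_smooth hk hg), partialD_mollify hk hg,
      ih (hk.partialD i), classicalD_add_single hk.contDiff]

theorem mollify_indicator {Ω : Set (Rn N)} (hΩ : MeasurableSet Ω) (k g : Rn N → ℝ) (x : Rn N) :
    mollify k (Ω.indicator g) x = ∫ t in Ω, g t * k (x - t) := by
  rw [mollify, ← integral_indicator hΩ]
  congr 1
  ext t
  by_cases ht : t ∈ Ω <;> simp [ht]

/-- Mollification commutes with weak derivatives, at points where the kernel does not reach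
beyond `Ω`. -/
theorem mollify_hasWeakDeriv {Ω : Set (Rn N)} (hΩ : MeasurableSet Ω) {k u v : Rn N → ℝ}
    {α : Fin N → ℕ} (h : HasWeakDeriv Ω α u v) (hk : ContDiff ℝ ∞ k) {x : Rn N}
    (hx : IsTestFunction Ω fun t => k (x - t)) :
    mollify (classicalD α k) (Ω.indicator u) x = mollify k (Ω.indicator v) x := by
  rw [mollify_indicator hΩ, mollify_indicator hΩ]
  have e := h.integral_eq _ hx
  have hs : ((-1 : ℝ) ^ (∑ i, α i)) * (-1) ^ (∑ i, α i) = 1 := by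
    rw [← pow_add, Even.neg_one_pow ⟨_, rfl⟩]
  rw [classicalD_comp_sub hk] at e
  calc ∫ t in Ω, u t * classicalD α k (x - t)
      = (-1) ^ (∑ i, α i) * ∫ t in Ω, u t * ((-1) ^ (∑ i, α i) * classicalD α k (x - t)) := by
        rw [← integral_const_mul]
        congr 1
        ext t
        linear_combination (-(u t * classicalD α k (x - t))) * hs
    _ = _ := by rw [e, ← mul_assoc, hs, one_mul]

/-- Convolution with a probability density does not increase the `L²` norm, by Jensen's
inequality `(g * k)² ≤ g² * k`. -/
theorem eLpNorm_mollify_le {Ω : Set (Rn N)} {k g : Rn N → ℝ} (hk : IsTestFunction Ω k)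
    (hk0 : ∀ x, 0 ≤ k x) (hk1 : ∫ x, k x = 1) (hg : MemLp g 2 volume) :
    eLpNorm (mollify k g) 2 volume ≤ eLpNorm g 2 volume := by
  have hgl : LocallyIntegrable g := hg.locallyIntegrable (by norm_num)
  have hkc := hk.contDiff.continuous
  have hki : Integrable k := hkc.integrable_of_hasCompactSupport hk.hasCompactSupport
  have hg2 : Integrable (fun x => g x ^ 2) := hg.integrable_sq
  have hex : ∀ {h : Rn N → ℝ}, LocallyIntegrable h → ∀ x,
      Integrable fun t => h t * k (x - t) := fun hh x =>
    hk.hasCompactSupport.convolutionExists_right (ContinuousLinearMap.mul ℝ ℝ) hh hkc x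
  have hkx : ∀ x, ∫ t, k (x - t) = 1 := fun x => by rw [integral_sub_left_eq_self k, hk1]
  have hkxi : ∀ x, Integrable fun t => k (x - t) := fun x => hki.comp_sub_left x
  have jensen : ∀ x, mollify k g x ^ 2 ≤ mollify k (fun t => g t ^ 2) x := by
    intro x
    set c := mollify k g x with hc
    have i1 := hex hg2.locallyIntegrable x
    have i2 := hex hgl x
    -- The variance of `g` under the probability density `k (x - ·)` is nonnegative.
    have h0 : 0 ≤ ∫ t, (g t - c) ^ 2 * k (x - t) :=
      integral_nonneg fun t => mul_nonneg (sq_nonneg _) (hk0 _)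
    have h1 : ∫ t, (g t - c) ^ 2 * k (x - t) =
        mollify k (fun t => g t ^ 2) x - 2 * c * c + c ^ 2 := by
      have : ∀ t, (g t - c) ^ 2 * k (x - t) =
          (g t ^ 2 * k (x - t) - 2 * c * (g t * k (x - t))) + c ^ 2 * k (x - t) := fun t => by ring
      simp only [this]
      calc ∫ t, ((g t ^ 2 * k (x - t) - 2 * c * (g t * k (x - t))) + c ^ 2 * k (x - t))
          = (∫ t, (g t ^ 2 * k (x - t) - 2 * c * (g t * k (x - t)))) + ∫ t, c ^ 2 * k (x - t) :=
            integral_add (i1.sub (i2.const_mul _)) ((hkxi x).const_mul _)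
        _ = _ := by
            rw [integral_sub i1 (i2.const_mul _), integral_const_mul, integral_const_mul, hkx,
              mul_one]
            rfl
    rw [h1] at h0
    linarith [sq c]
  have hmi : Integrable (mollify k fun t => g t ^ 2) :=
    hg2.integrable_convolution (ContinuousLinearMap.mul ℝ ℝ) hki
  have hms : Continuous (mollify k g) := (mollify_smooth hk hgl).continuous
  have hsq : Integrable (fun x => mollify k g x ^ 2) :=
    hmi.mono' (hms.pow 2).aestronglyMeasurable (Filter.Eventually.of_forall fun x => by
      rw [Real.norm_of_nonneg (sq_nonneg _)]
      exact jensen x)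
  have hm : MemLp (mollify k g) 2 volume :=
    (memLp_two_iff_integrable_sq hms.aestronglyMeasurable).mpr hsq
  rw [eLpNorm_two_eq hm, eLpNorm_two_eq hg]
  refine ENNReal.ofReal_le_ofReal (Real.sqrt_le_sqrt ?_)
  calc ∫ x, mollify k g x ^ 2 ≤ ∫ x, mollify k (fun t => g t ^ 2) x :=
        integral_mono hsq hmi jensen
    _ = ∫ x, g x ^ 2 := by
        rw [mollify_eq_convolution, integral_convolution _ hg2 hki, hk1]
        simp

theorem isTestFunction_normed (φ : ContDiffBump (0 : Rn N)) :
    IsTestFunction Set.univ (φ.normed volume) :=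
  ⟨φ.contDiff_normed (n := ⊤), φ.hasCompactSupport_normed, Set.subset_univ _⟩

/-- Mollifications converge to `g` when tested against continuous functions with compact support:
the mollifier is even, hence may be moved to the test function, where convergence is uniform. -/
theorem tendsto_integral_mollify_mul {φ : ℕ → ContDiffBump (0 : Rn N)}
    (hφ : Filter.Tendsto (fun n => (φ n).rOut) Filter.atTop (nhds 0)) {g ψ : Rn N → ℝ}
    (hg : Integrable g) (hψ : Continuous ψ) (hψc : HasCompactSupport ψ) :
    Filter.Tendsto (fun n => ∫ x, mollify ((φ n).normed volume) g x * ψ x) Filter.atTop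
      (nhds (∫ x, g x * ψ x)) := by
  have hψi : Integrable ψ := hψ.integrable_of_hasCompactSupport hψc
  obtain ⟨B, hB⟩ := hψc.exists_bound_of_continuous hψ
  -- By Fubini the mollifier moves to `ψ`; it is even, so the result is again a mollification.
  have hswap : ∀ n, ∫ x, mollify ((φ n).normed volume) g x * ψ x =
      ∫ t, g t * (∫ x, (φ n).normed volume (t - x) * ψ x) := by
    intro n
    have hc := (φ n).continuous_normed (μ := volume)
    obtain ⟨D, hD⟩ := (φ n).hasCompactSupport_normed (μ := volume) |>.exists_bound_of_continuous hc
    have hint : Integrable (Function.uncurry fun x t : Rn N =>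
        g t * (φ n).normed volume (x - t) * ψ x) (volume.prod volume) := by
      have h1 : Integrable (fun z : Rn N × Rn N => ψ z.1 * g z.2) (volume.prod volume) :=
        hψi.mul_prod hg
      have h2 := h1.bdd_mul (f := fun z : Rn N × Rn N => (φ n).normed volume (z.1 - z.2)) (c := D)
        (hc.comp (continuous_fst.sub continuous_snd)).aestronglyMeasurable
        (Filter.Eventually.of_forall fun z => hD _)
      refine h2.congr (Filter.Eventually.of_forall fun z => ?_)
      simp only [Function.uncurry]
      ring
    calc ∫ x, mollify ((φ n).normed volume) g x * ψ x
        = ∫ x, ∫ t, g t * (φ n).normed volume (x - t) * ψ x := by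
          simp only [mollify, integral_mul_const]
      _ = ∫ t, ∫ x, g t * (φ n).normed volume (x - t) * ψ x := integral_integral_swap hint
      _ = _ := by
          congr 1
          ext t
          rw [← integral_const_mul]
          congr 1
          ext x
          rw [← neg_sub t x, (φ n).normed_neg]
          ring
  simp only [hswap]
  refine tendsto_integral_of_dominated_convergence (fun t => ‖g t‖ * B) ?_
    (hg.norm.mul_const B) ?_ ?_
  · intro n
    have hc := (φ n).continuous_normed (μ := volume)
    refine hg.aestronglyMeasurable.mul (Continuous.aestronglyMeasurable ?_)
    have := (φ n).hasCompactSupport_normed (μ := volume) |>.continuous_convolution_right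
      (ContinuousLinearMap.mul ℝ ℝ) hψi.locallyIntegrable hc
    refine this.congr fun t => ?_
    simp [convolution, mul_comm]
  · intro n
    refine Filter.Eventually.of_forall fun t => ?_
    rw [norm_mul]
    refine mul_le_mul_of_nonneg_left ?_ (norm_nonneg _)
    have hi : Integrable fun x => (φ n).normed volume (t - x) * B :=
      ((φ n).integrable_normed.comp_sub_left t).mul_const B
    refine (norm_integral_le_of_norm_le hi (Filter.Eventually.of_forall fun x => ?_)).trans ?_
    · rw [norm_mul, Real.norm_of_nonneg ((φ n).nonneg_normed _)]
      exact mul_le_mul_of_nonneg_left (hB x) ((φ n).nonneg_normed _)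
    · rw [integral_mul_const, integral_sub_left_eq_self ((φ n).normed volume),
        (φ n).integral_normed, one_mul]
  · refine Filter.Eventually.of_forall fun t => Filter.Tendsto.const_mul _ ?_
    have := ContDiffBump.convolution_tendsto_right_of_continuous (μ := volume) hφ hψ t
    refine this.congr fun n => ?_
    rw [convolution_lsmul_swap]
    simp

/-- The mollifier centred at `x` is a test function in `B(0, R')` if `x` has at least the distance
`φ.rOut` from its boundary. -/
theorem isTestFunction_normed_comp_sub (φ : ContDiffBump (0 : Rn N)) {R R' : ℝ}
    (hR : R + φ.rOut ≤ R') {x : Rn N} (hx : x ∈ Metric.ball (0 : Rn N) R) :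
    IsTestFunction (Metric.ball 0 R') fun t => φ.normed volume (x - t) := by
  have hts : tsupport (fun t => φ.normed volume (x - t)) ⊆ Metric.closedBall x φ.rOut := by
    refine closure_minimal (fun t ht => ?_) Metric.isClosed_closedBall
    have : x - t ∈ Function.support (φ.normed volume) := ht
    rw [φ.support_normed_eq, mem_ball_zero_iff] at this
    rw [Metric.mem_closedBall, dist_eq_norm, norm_sub_rev]
    exact this.le
  refine ⟨(isTestFunction_normed φ).contDiff.comp (contDiff_const.sub contDiff_id),
    (isCompact_closedBall x φ.rOut).of_isClosed_subset (isClosed_tsupport _) hts,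
    hts.trans fun t ht => ?_⟩
  rw [mem_ball_zero_iff] at hx ⊢
  rw [Metric.mem_closedBall, dist_eq_norm] at ht
  calc ‖t‖ = ‖(t - x) + x‖ := by rw [sub_add_cancel]
    _ ≤ ‖t - x‖ + ‖x‖ := norm_add_le _ _
    _ < R' := by linarith

theorem locallyIntegrable_indicator {Ω : Set (Rn N)} (hΩ : MeasurableSet Ω) {v : Rn N → ℝ}
    (hv : MemLp v 2 (volume.restrict Ω)) : LocallyIntegrable (Ω.indicator v) :=
  ((memLp_indicator_iff_restrict hΩ).mpr hv).locallyIntegrable (by norm_num)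

/-- The derivatives of the mollification of `u ∈ L²(B(0, R'))` are the mollifications of its weak
derivatives, in a smaller ball. -/
theorem classicalD_mollify_eqOn (φ : ContDiffBump (0 : Rn N)) {R R' : ℝ} (hR : R + φ.rOut ≤ R')
    {u v : Rn N → ℝ} (hu : MemLp u 2 (volume.restrict (Metric.ball 0 R'))) {α : Fin N → ℕ}
    (h : HasWeakDeriv (Metric.ball 0 R') α u v) :
    Set.EqOn (classicalD α (mollify (φ.normed volume) ((Metric.ball 0 R').indicator u)))
      (mollify (φ.normed volume) ((Metric.ball 0 R').indicator v)) (Metric.ball 0 R) := by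
  intro x hx
  rw [classicalD_mollify (isTestFunction_normed φ)
    (locallyIntegrable_indicator measurableSet_ball hu)]
  exact mollify_hasWeakDeriv measurableSet_ball h (isTestFunction_normed φ).contDiff
    (isTestFunction_normed_comp_sub φ hR hx)

theorem eLpNorm_classicalD_mollify_le (φ : ContDiffBump (0 : Rn N)) {R R' : ℝ}
    (hR : R + φ.rOut ≤ R') {u v : Rn N → ℝ}
    (hu : MemLp u 2 (volume.restrict (Metric.ball 0 R')))
    (hv : MemLp v 2 (volume.restrict (Metric.ball 0 R'))) {α : Fin N → ℕ}
    (h : HasWeakDeriv (Metric.ball 0 R') α u v) :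
    eLpNorm (classicalD α (mollify (φ.normed volume) ((Metric.ball 0 R').indicator u))) 2
      (volume.restrict (Metric.ball 0 R)) ≤ eLpNorm v 2 (volume.restrict (Metric.ball 0 R')) := by
  have hB : MeasurableSet (Metric.ball (0 : Rn N) R') := measurableSet_ball
  have hae := (ae_restrict_iff' (μ := volume)
    (measurableSet_ball (x := (0 : Rn N)) (ε := R))).mpr
    (Filter.Eventually.of_forall (classicalD_mollify_eqOn φ hR hu h))
  have hle := eLpNorm_mollify_le (isTestFunction_normed φ)
    (φ.nonneg_normed (μ := volume)) (φ.integral_normed (μ := volume))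
    ((memLp_indicator_iff_restrict hB).mpr hv)
  rw [eLpNorm_indicator_eq_eLpNorm_restrict hB] at hle
  refine (eLpNorm_congr_ae hae).le.trans ?_
  exact (eLpNorm_mono_measure _ Measure.restrict_le_self).trans hle

/-- If `∑ a_{α,β} ∫ ∂^α u ∂^β ψ = ∫ f ψ` for all test functions `ψ` in `B(0, R')`, then the
mollifications of `u` and `f` solve the same equation in a smaller ball: at a point `x` the
equation for `u` is tested with the mollifier centred at `x`. -/
theorem mollify_weak_equation {m : ℕ} {a : Coeff N} (φ : ContDiffBump (0 : Rn N)) {R R' : ℝ}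
    (hR : R + φ.rOut ≤ R') {u f : Rn N → ℝ} {v : (Fin N → ℕ) → Rn N → ℝ}
    (hu : MemLp u 2 (volume.restrict (Metric.ball 0 R')))
    (hv : ∀ α ∈ multiIdx N m, MemLp (v α) 2 (volume.restrict (Metric.ball 0 R')))
    (hd : ∀ α ∈ multiIdx N m, HasWeakDeriv (Metric.ball 0 R') α u (v α))
    (heq : ∀ ψ : Rn N → ℝ, IsTestFunction (Metric.ball 0 R') ψ →
      ∑ α ∈ multiIdx N m, ∑ β ∈ multiIdx N m,
        a α β * ∫ x in Metric.ball 0 R', v α x * classicalD β ψ x =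
      ∫ x in Metric.ball 0 R', f x * ψ x)
    {ψ : Rn N → ℝ} (hψ : IsTestFunction (Metric.ball 0 R) ψ) :
    ∑ α ∈ multiIdx N m, ∑ β ∈ multiIdx N m,
      a α β * ∫ x, classicalD α (mollify (φ.normed volume) ((Metric.ball 0 R').indicator u)) x *
        classicalD β ψ x =
    ∫ x, mollify (φ.normed volume) ((Metric.ball 0 R').indicator f) x * ψ x := by
  have hk := isTestFunction_normed φ
  have hus := mollify_smooth hk (locallyIntegrable_indicator measurableSet_ball hu)
  set U := mollify (φ.normed volume) ((Metric.ball 0 R').indicator u) with hU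
  have hs : ((-1 : ℝ) ^ m) * (-1) ^ m = 1 := by
    rw [← pow_add, Even.neg_one_pow ⟨_, rfl⟩]
  -- The pointwise form of the equation.
  have hpt : ∀ x ∈ Metric.ball (0 : Rn N) R,
      ∑ α ∈ multiIdx N m, ∑ β ∈ multiIdx N m,
        a α β * ((-1) ^ m * classicalD β (classicalD α U) x) =
      mollify (φ.normed volume) ((Metric.ball 0 R').indicator f) x := by
    intro x hx
    have hx' := isTestFunction_normed_comp_sub φ hR hx
    rw [mollify_indicator measurableSet_ball, ← heq _ hx']
    refine Finset.sum_congr rfl fun α hα => Finset.sum_congr rfl fun β hβ => ?_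
    have hvl := locallyIntegrable_indicator measurableSet_ball (hv α hα)
    rw [classicalD_congr (classicalD_smooth hus α) (mollify_smooth hk hvl) Metric.isOpen_ball
      (classicalD_mollify_eqOn φ hR hu (hd α hα)) β hx, classicalD_mollify hk hvl,
      mollify_indicator measurableSet_ball, classicalD_comp_sub hk.contDiff, mem_multiIdx.mp hβ,
      ← integral_const_mul]
    congr 2
    ext t
    ring
  calc _ = ∑ α ∈ multiIdx N m, ∑ β ∈ multiIdx N m,
        ∫ x, a α β * ((-1) ^ m * classicalD β (classicalD α U) x) * ψ x := by
        refine Finset.sum_congr rfl fun α _ => Finset.sum_congr rfl fun β hβ => ?_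
        rw [integral_mul_classicalD (classicalD_smooth hus α) hψ, mem_multiIdx.mp hβ,
          ← integral_const_mul, ← integral_const_mul]
        simp only [mul_assoc]
    _ = ∫ x, (∑ α ∈ multiIdx N m, ∑ β ∈ multiIdx N m,
        a α β * ((-1) ^ m * classicalD β (classicalD α U) x)) * ψ x := by
        have hi : ∀ α β, Integrable fun x =>
            a α β * ((-1) ^ m * classicalD β (classicalD α U) x) * ψ x := fun α β =>
          hψ.integrable_mul (contDiff_const.mul
            (contDiff_const.mul (classicalD_smooth (classicalD_smooth hus α) β)))
        simp only [Finset.sum_mul]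
        rw [integral_finsetSum _ fun α _ => integrable_finsetSum _ fun β _ => hi α β]
        exact Finset.sum_congr rfl fun α _ => (integral_finsetSum _ fun β _ => hi α β).symm
    _ = _ := by
        rw [← hψ.setIntegral_mul, ← hψ.setIntegral_mul]
        exact setIntegral_congr_fun measurableSet_ball fun x hx => by simp only [hpt x hx]

/-! ### Weak derivatives -/

theorem integrableOn_of_memLp_two {Ω : Set (Rn N)} {v : Rn N → ℝ} (hΩ : volume Ω ≠ ⊤)
    (hv : MemLp v 2 (volume.restrict Ω)) : IntegrableOn v Ω volume := by
  have : IsFiniteMeasure (volume.restrict Ω) := isFiniteMeasure_restrict.mpr hΩ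
  exact hv.integrable (by norm_num)

theorem integrable_memLp_mul_test {Ω Ω' : Set (Rn N)} {v ψ : Rn N → ℝ}
    (hv : MemLp v 2 (volume.restrict Ω)) (hψ : IsTestFunction Ω' ψ) :
    Integrable (fun x => v x * ψ x) (volume.restrict Ω) :=
  hv.integrable_mul (q := 2)
    ((hψ.contDiff.continuous.memLp_of_hasCompactSupport hψ.hasCompactSupport).restrict Ω)

/-- Weak derivatives are unique almost everywhere. -/
theorem HasWeakDeriv.ae_eq {Ω : Set (Rn N)} (hΩ : IsOpen Ω) {α : Fin N → ℕ} {u v v' : Rn N → ℝ}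
    (h : HasWeakDeriv Ω α u v) (h' : HasWeakDeriv Ω α u v') : v =ᵐ[volume.restrict Ω] v' := by
  have hz := hΩ.ae_eq_zero_of_integral_contDiff_smul_eq_zero
    (h.locInt_deriv.sub h'.locInt_deriv) (μ := volume) fun g hg hgc hgs => ?_
  · refine (ae_restrict_iff' hΩ.measurableSet).mpr (hz.mono fun x hx hxΩ => ?_)
    exact sub_eq_zero.mp (hx hxΩ)
  · have ht : IsTestFunction Ω g := ⟨hg, hgc, hgs⟩
    have hi : ∀ {w : Rn N → ℝ}, LocallyIntegrableOn w Ω volume →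
        IntegrableOn (fun x => w x * g x) Ω volume := fun {w} hw => by
      have h1 : IntegrableOn w (tsupport g) volume := hw.integrableOn_compact_subset hgs hgc
      have h2 : IntegrableOn (fun x => w x * g x) (tsupport g) volume :=
        h1.mul_continuousOn hg.continuous.continuousOn hgc
      have h3 : Integrable (fun x => w x * g x) volume :=
        (integrableOn_iff_integrable_of_support_subset fun x hx =>
          subset_tsupport g fun h0 => hx (by simp [h0])).mp h2
      exact h3.integrableOn
    have e : ∫ x in Ω, v x * g x = ∫ x in Ω, v' x * g x := by
      have := (h.integral_eq g ht).symm.trans (h'.integral_eq g ht)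
      exact mul_left_cancel₀ (pow_ne_zero _ (by norm_num)) this
    calc ∫ x, g x • (v - v') x = ∫ x, (v x - v' x) * g x := by
          congr 1
          ext x
          simp [mul_comm]
      _ = ∫ x in Ω, (v x - v' x) * g x := (ht.setIntegral_mul fun x => v x - v' x).symm
      _ = 0 := by
          simp only [sub_mul]
          rw [integral_sub (hi h.locInt_deriv) (hi h'.locInt_deriv), e, sub_self]

theorem hasWeakDeriv_weakDeriv {Ω : Set (Rn N)} {α : Fin N → ℕ} {u : Rn N → ℝ}
    (h : ∃ v, HasWeakDeriv Ω α u v) : HasWeakDeriv Ω α u (weakDeriv Ω α u) := by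
  rw [weakDeriv, dif_pos h]
  exact h.choose_spec

theorem HasWeakDeriv.weakDeriv_ae_eq {Ω : Set (Rn N)} (hΩ : IsOpen Ω) {α : Fin N → ℕ}
    {u v : Rn N → ℝ} (h : HasWeakDeriv Ω α u v) :
    weakDeriv Ω α u =ᵐ[volume.restrict Ω] v :=
  (hasWeakDeriv_weakDeriv ⟨v, h⟩).ae_eq hΩ h

theorem IsTestFunction.hasWeakDeriv {Ω : Set (Rn N)} {ψ : Rn N → ℝ} (hψ : IsTestFunction Ω ψ)
    (α : Fin N → ℕ) : HasWeakDeriv Ω α ψ (InteriorReg.classicalD α ψ) where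
  locInt := hψ.contDiff.continuous.locallyIntegrable.locallyIntegrableOn Ω
  locInt_deriv := (hψ.classicalD α).contDiff.continuous.locallyIntegrable.locallyIntegrableOn Ω
  integral_eq φ hφ := by
    rw [(hφ.classicalD α).setIntegral_mul, hφ.setIntegral_mul,
      integral_mul_classicalD hψ.contDiff hφ]

theorem hasWeakDeriv_zero (Ω : Set (Rn N)) (α : Fin N → ℕ) :
    HasWeakDeriv Ω α (0 : Rn N → ℝ) 0 where
  locInt := locallyIntegrableOn_zero
  locInt_deriv := locallyIntegrableOn_zero
  integral_eq φ _ := by simp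

/-- Test functions are admissible in the weak formulation. -/
theorem IsTestFunction.memSobolevZero {Ω : Set (Rn N)} (hΩ : IsOpen Ω) {ψ : Rn N → ℝ}
    (hψ : IsTestFunction Ω ψ) (k : ℕ) : MemSobolevZero k Ω ψ where
  memSobolev :=
    { memLp := (hψ.contDiff.continuous.memLp_of_hasCompactSupport hψ.hasCompactSupport).restrict Ω
      exists_weakDeriv := fun α _ => ⟨_, hψ.hasWeakDeriv α,
        ((hψ.classicalD α).contDiff.continuous.memLp_of_hasCompactSupport
          (hψ.classicalD α).hasCompactSupport).restrict Ω⟩ }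
  approx ε hε := by
    refine ⟨ψ, hψ, ?_⟩
    have h0 : ∀ α, lpNorm (weakDeriv Ω α (0 : Rn N → ℝ)) 2 (volume.restrict Ω) = 0 := fun α => by
      have h := (hasWeakDeriv_zero Ω α).weakDeriv_ae_eq hΩ
      exact (lpNorm_eq_zero ((memLp_congr_ae h).mpr MemLp.zero) (by norm_num)).mpr h
    simpa [sobolevNorm, h0] using hε

theorem MemSobolev.memLp_weakDeriv {Ω : Set (Rn N)} (hΩ : IsOpen Ω) {k : ℕ} {u : Rn N → ℝ}
    (h : MemSobolev k Ω u) {α : Fin N → ℕ} (hα : ∑ i, α i ≤ k) :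
    MemLp (weakDeriv Ω α u) 2 (volume.restrict Ω) := by
  obtain ⟨v, hv, hv2⟩ := h.exists_weakDeriv α hα
  exact (memLp_congr_ae (hv.weakDeriv_ae_eq hΩ)).mpr hv2

theorem MemSobolev.hasWeakDeriv {Ω : Set (Rn N)} {k : ℕ} {u : Rn N → ℝ}
    (h : MemSobolev k Ω u) {α : Fin N → ℕ} (hα : ∑ i, α i ≤ k) :
    HasWeakDeriv Ω α u (weakDeriv Ω α u) :=
  hasWeakDeriv_weakDeriv ((h.exists_weakDeriv α hα).imp fun _ hv => hv.1)

theorem MemSobolev.eLpNorm_weakDeriv_le {Ω : Set (Rn N)} (hΩ : IsOpen Ω) {k : ℕ} {u : Rn N → ℝ}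
    (h : MemSobolev k Ω u) {α : Fin N → ℕ} (hα : ∑ i, α i ≤ k) :
    eLpNorm (weakDeriv Ω α u) 2 (volume.restrict Ω) ≤
      ENNReal.ofReal (sobolevNorm k Ω u) := by
  rw [← ofReal_lpNorm (h.memLp_weakDeriv hΩ hα)]
  refine ENNReal.ofReal_le_ofReal (Real.le_sqrt_of_sq_le ?_)
  refine le_trans ?_ (Finset.single_le_sum
    (f := fun j => ∑ α ∈ multiIdx N j, lpNorm (weakDeriv Ω α u) 2 (volume.restrict Ω) ^ 2)
    (fun j _ => Finset.sum_nonneg fun _ _ => sq_nonneg _)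
    (Finset.mem_range.mpr (Nat.lt_succ_of_le hα)))
  exact Finset.single_le_sum
    (f := fun α => lpNorm (weakDeriv Ω α u) 2 (volume.restrict Ω) ^ 2)
    (fun _ _ => sq_nonneg _) (mem_multiIdx.mpr rfl)

theorem sobolevNorm_le {Ω : Set (Rn N)} {k : ℕ} {u : Rn N → ℝ} {K : ℝ} (hK : 0 ≤ K)
    (h : ∀ α : Fin N → ℕ, ∑ i, α i ≤ k →
      lpNorm (weakDeriv Ω α u) 2 (volume.restrict Ω) ≤ K) :
    sobolevNorm k Ω u ≤ Real.sqrt (∑ j ∈ Finset.range (k + 1), ((multiIdx N j).card : ℝ)) * K := by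
  rw [sobolevNorm, ← Real.sqrt_sq hK, ← Real.sqrt_mul (by positivity)]
  refine Real.sqrt_le_sqrt ?_
  rw [Finset.sum_mul]
  refine Finset.sum_le_sum fun j hj => ?_
  rw [← nsmul_eq_mul]
  refine Finset.sum_le_card_nsmul _ _ _ fun α hα => ?_
  refine pow_le_pow_left₀ lpNorm_nonneg (h α ?_) 2
  rw [mem_multiIdx.mp hα]
  exact Nat.lt_succ_iff.mp (Finset.mem_range.mp hj)

/-- The weak formulation for test functions, with their classical derivatives and with the sums
outside of the integral. -/
theorem IsWeakSolution.test_eq {Ω : Set (Rn N)} (hΩ : IsOpen Ω) {m : ℕ} {a : Coeff N}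
    {u f : Rn N → ℝ} (h : IsWeakSolution m a Ω u f) {ψ : Rn N → ℝ} (hψ : IsTestFunction Ω ψ) :
    ∑ α ∈ multiIdx N m, ∑ β ∈ multiIdx N m,
      a α β * ∫ x in Ω, weakDeriv Ω α u x * classicalD β ψ x = ∫ x in Ω, f x * ψ x := by
  have hi : ∀ α ∈ multiIdx N m, ∀ β, Integrable
      (fun x => a α β * (weakDeriv Ω α u x * classicalD β ψ x)) (volume.restrict Ω) :=
    fun α hα β => (integrable_memLp_mul_test
      (h.memSobolev.memLp_weakDeriv hΩ (mem_multiIdx.mp hα).le) (hψ.classicalD β)).const_mul _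
  have hae : ∀ᵐ x ∂volume.restrict Ω, ∀ β ∈ multiIdx N m,
      weakDeriv Ω β ψ x = classicalD β ψ x :=
    (Finset.eventually_all _).mpr fun β _ => (hψ.hasWeakDeriv β).weakDeriv_ae_eq hΩ
  simp only [mul_comm (f _)]
  rw [← h.weak_eq ψ (hψ.memSobolevZero hΩ m)]
  simp only [← integral_const_mul]
  rw [integral_congr_ae (hae.mono fun x hx => Finset.sum_congr rfl fun α _ =>
      Finset.sum_congr rfl fun β hβ => by
        rw [hx β hβ, mul_assoc] :
      (fun x => ∑ α ∈ multiIdx N m, ∑ β ∈ multiIdx N m,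
        a α β * weakDeriv Ω α u x * weakDeriv Ω β ψ x) =ᵐ[volume.restrict Ω] fun x =>
      ∑ α ∈ multiIdx N m, ∑ β ∈ multiIdx N m,
        a α β * (weakDeriv Ω α u x * classicalD β ψ x)),
    integral_finsetSum _ fun α hα => integrable_finsetSum _ fun β _ => hi α hα β]
  exact Finset.sum_congr rfl fun α hα => (integral_finsetSum _ fun β _ => hi α hα β).symm

/-! ### Passage to the limit -/

/-- A bounded sequence in a Hilbert space has a weak limit along an ultrafilter, in the ball of the
same radius. -/
theorem exists_weak_limit {H : Type*} [NormedAddCommGroup H] [InnerProductSpace ℝ H]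
    [CompleteSpace H] {V : ℕ → H} {K : ℝ} (hV : ∀ n, ‖V n‖ ≤ K) :
    ∃ v : H, ‖v‖ ≤ K ∧ ∀ w : H, Filter.Tendsto (fun n => inner ℝ (V n) w)
      (Filter.hyperfilter ℕ : Filter ℕ) (nhds (inner ℝ v w)) := by
  let T : ℕ → WeakDual ℝ H := fun n => StrongDual.toWeakDual (InnerProductSpace.toDual ℝ H (V n))
  have hT : ∀ n, T n ∈ WeakDual.toStrongDual ⁻¹' Metric.closedBall (0 : StrongDual ℝ H) K := by
    intro n
    simpa [T] using hV n
  obtain ⟨L, hL, hle⟩ := (WeakDual.isCompact_closedBall (0 : StrongDual ℝ H) K).ultrafilter_le_nhds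
    ((Filter.hyperfilter ℕ).map T) (by
      refine Filter.le_principal_iff.mpr ?_
      exact Filter.mem_map.mpr (Filter.univ_mem' hT))
  refine ⟨(InnerProductSpace.toDual ℝ H).symm (WeakDual.toStrongDual L), by simpa using hL,
    fun w => ?_⟩
  rw [InnerProductSpace.toDual_symm_apply]
  exact ((WeakDual.eval_continuous w).tendsto L).comp hle

/-- If the derivatives `∂^α U_n` are bounded in `L²(Ω)` and `U_n → u` in the sense of
distributions, then `u` has a weak derivative `∂^α u` in `L²(Ω)` with the same bound. -/
theorem exists_weakDeriv_of_bounded {Ω : Set (Rn N)} (hΩ : volume Ω ≠ ⊤) {α : Fin N → ℕ}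
    {u : Rn N → ℝ} (hu : LocallyIntegrableOn u Ω volume) {U : ℕ → Rn N → ℝ}
    (hU : ∀ n, ContDiff ℝ ∞ (U n)) {K : ℝ} (hK : 0 ≤ K)
    (hb : ∀ n, eLpNorm (classicalD α (U n)) 2 (volume.restrict Ω) ≤ ENNReal.ofReal K)
    (hconv : ∀ ψ, IsTestFunction Ω ψ → Filter.Tendsto (fun n => ∫ x, U n x * ψ x) Filter.atTop
      (nhds (∫ x in Ω, u x * ψ x))) :
    ∃ v, HasWeakDeriv Ω α u v ∧ MemLp v 2 (volume.restrict Ω) ∧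
      lpNorm v 2 (volume.restrict Ω) ≤ K := by
  have hm : ∀ n, MemLp (classicalD α (U n)) 2 (volume.restrict Ω) := fun n =>
    ⟨smooth_aesm (classicalD_smooth (hU n) α) _, (hb n).trans_lt ENNReal.ofReal_lt_top⟩
  obtain ⟨v, hv, hlim⟩ := exists_weak_limit (V := fun n => (hm n).toLp _) (K := K) fun n => by
    rw [Lp.norm_toLp]
    exact ENNReal.toReal_le_of_le_ofReal hK (hb n)
  have hv2 : MemLp v 2 (volume.restrict Ω) := Lp.memLp v
  refine ⟨v, ⟨hu, (integrableOn_of_memLp_two hΩ hv2).locallyIntegrableOn, fun ψ hψ => ?_⟩, hv2, ?_⟩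
  · have hψ2 : MemLp ψ 2 (volume.restrict Ω) :=
      (hψ.contDiff.continuous.memLp_of_hasCompactSupport hψ.hasCompactSupport).restrict Ω
    have h1 : ∀ n, inner ℝ ((hm n).toLp _) (hψ2.toLp ψ) =
        (-1) ^ (∑ i, α i) * ∫ x, U n x * classicalD α ψ x := by
      intro n
      rw [integral_mul_classicalD (hU n) hψ, ← mul_assoc, ← pow_add, Even.neg_one_pow ⟨_, rfl⟩,
        one_mul, ← hψ.setIntegral_mul, L2.inner_def]
      refine integral_congr_ae ?_
      filter_upwards [(hm n).coeFn_toLp, hψ2.coeFn_toLp] with x h1 h2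
      rw [h1, h2]
      simp [mul_comm]
    have h2 : inner ℝ v (hψ2.toLp ψ) = ∫ x in Ω, v x * ψ x := by
      rw [L2.inner_def]
      refine integral_congr_ae ?_
      filter_upwards [hψ2.coeFn_toLp] with x h2
      rw [h2]
      simp [mul_comm]
    have h3 := hlim (hψ2.toLp ψ)
    simp only [h1, h2] at h3
    have h4 := ((hconv _ (hψ.classicalD α)).mono_left
      Nat.hyperfilter_le_atTop).const_mul ((-1 : ℝ) ^ (∑ i, α i))
    rw [tendsto_nhds_unique h3 h4, ← mul_assoc, ← pow_add, Even.neg_one_pow ⟨_, rfl⟩, one_mul]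
  · rw [← toReal_eLpNorm hv2.1, ← Lp.norm_def]
    exact hv

/-- A sequence of mollifiers whose radii tend to `0` and are at most `1 / 4`, the distance of
`B(0, 3/4)` from the boundary of `B(0, 1)`. -/
def mollifierSeq (N n : ℕ) : ContDiffBump (0 : Rn N) :=
  ⟨1 / (8 * (n + 1)), 1 / (4 * (n + 1)), by positivity, by
    apply one_div_lt_one_div_of_lt <;> nlinarith [(Nat.cast_nonneg n : (0 : ℝ) ≤ n)]⟩

theorem mollifierSeq_rOut_le (N n : ℕ) : 3 / 4 + (mollifierSeq N n).rOut ≤ 1 := by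
  have : 1 / (4 * ((n : ℝ) + 1)) ≤ 1 / 4 :=
    one_div_le_one_div_of_le (by norm_num) (by nlinarith [(Nat.cast_nonneg n : (0 : ℝ) ≤ n)])
  change 3 / 4 + 1 / (4 * ((n : ℝ) + 1)) ≤ 1
  linarith

theorem tendsto_mollifierSeq_rOut (N : ℕ) :
    Filter.Tendsto (fun n => (mollifierSeq N n).rOut) Filter.atTop (nhds 0) := by
  have h := (tendsto_one_div_add_atTop_nhds_zero_nat (𝕜 := ℝ)).const_mul (1 / 4)
  rw [mul_zero] at h
  refine h.congr fun n => ?_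
  change _ = 1 / (4 * ((n : ℝ) + 1))
  rw [one_div_mul_one_div]

theorem derivBound_mollify {k : ℕ} {u : Rn N → ℝ} (hu : MemSobolev k (Metric.ball 0 1) u) {K : ℝ}
    (hK : sobolevNorm k (Metric.ball 0 1) u ≤ K) (n : ℕ) :
    DerivBound (k + 1) (Metric.ball 0 (3 / 4))
      (mollify ((mollifierSeq N n).normed volume) ((Metric.ball 0 1).indicator u)) K := by
  intro α hα
  have hα' : ∑ i, α i ≤ k := Nat.lt_succ_iff.mp hα
  exact (eLpNorm_classicalD_mollify_le _ (mollifierSeq_rOut_le N n) hu.memLp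
    (hu.memLp_weakDeriv Metric.isOpen_ball hα') (hu.hasWeakDeriv hα')).trans
    ((hu.eLpNorm_weakDeriv_le Metric.isOpen_ball hα').trans (ENNReal.ofReal_le_ofReal hK))

/-- Interior regularity, in terms of the single derivatives `∂^α u` with `|α| ≤ 2 m + l`. -/
theorem exists_interior_bound {m : ℕ} (hm : 1 ≤ m) (l : ℕ) (M : ℝ) {lam : ℝ} (hlam : 0 < lam) :
    ∃ C : ℝ, 0 ≤ C ∧ ∀ a : Coeff N, IsEllipticWith m lam a →
      (∀ α ∈ multiIdx N m, ∀ β ∈ multiIdx N m, |a α β| ≤ M) →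
      ∀ u f : Rn N → ℝ, MemSobolev l (Metric.ball 0 1) f →
      IsWeakSolution m a (Metric.ball 0 1) u f → ∀ α : Fin N → ℕ, ∑ i, α i ≤ 2 * m + l →
      ∃ v, HasWeakDeriv (Metric.ball 0 (1 / 2)) α u v ∧
        MemLp v 2 (volume.restrict (Metric.ball 0 (1 / 2))) ∧
        lpNorm v 2 (volume.restrict (Metric.ball 0 (1 / 2))) ≤
          C * (sobolevNorm m (Metric.ball 0 1) u + sobolevNorm l (Metric.ball 0 1) f) := by
  obtain ⟨C, hC, hbound⟩ := exists_smooth_interior_bound (N := N) hm l M hlam (3 / 4) (m + l) le_rfl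
    (1 / 2) (by norm_num) (by norm_num)
  refine ⟨C, hC, fun a ha haM u f hf hu α hα => ?_⟩
  have hu0 : 0 ≤ sobolevNorm m (Metric.ball 0 1) u := Real.sqrt_nonneg _
  have hf0 : 0 ≤ sobolevNorm l (Metric.ball 0 1) f := Real.sqrt_nonneg _
  have huS := hu.memSobolev
  let k : ℕ → Rn N → ℝ := fun n => (mollifierSeq N n).normed volume
  let U : ℕ → Rn N → ℝ := fun n => mollify (k n) ((Metric.ball 0 1).indicator u)
  let F : ℕ → Rn N → ℝ := fun n => mollify (k n) ((Metric.ball 0 1).indicator f)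
  have hUs : ∀ n, ContDiff ℝ ∞ (U n) := fun n => mollify_smooth (isTestFunction_normed _)
    (locallyIntegrable_indicator measurableSet_ball huS.memLp)
  have hFs : ∀ n, ContDiff ℝ ∞ (F n) := fun n => mollify_smooth (isTestFunction_normed _)
    (locallyIntegrable_indicator measurableSet_ball hf.memLp)
  have hUb : ∀ n, DerivBound (m + (m + l) + 1) (Metric.ball 0 (1 / 2)) (U n)
      (C * (sobolevNorm m (Metric.ball 0 1) u + sobolevNorm l (Metric.ball 0 1) f)) := fun n =>
    hbound a ha haM (U n) (F n) _ (hUs n) (hFs n) (add_nonneg hu0 hf0)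
      (derivBound_mollify huS (le_add_of_nonneg_right hf0) n)
      (derivBound_mollify hf (le_add_of_nonneg_left hu0) n)
      fun φ hφ => mollify_weak_equation (mollifierSeq N n) (mollifierSeq_rOut_le N n) huS.memLp
        (fun α hα => huS.memLp_weakDeriv Metric.isOpen_ball (mem_multiIdx.mp hα).le)
        (fun α hα => huS.hasWeakDeriv (mem_multiIdx.mp hα).le)
        (fun ψ hψ => hu.test_eq Metric.isOpen_ball hψ) hφ
  have hsub : Metric.ball (0 : Rn N) (1 / 2) ⊆ Metric.ball 0 1 :=
    Metric.ball_subset_ball (by norm_num)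
  have hfin : ∀ r, volume (Metric.ball (0 : Rn N) r) ≠ ⊤ := fun r => measure_ball_lt_top.ne
  have hu1 : IntegrableOn u (Metric.ball 0 1) volume := integrableOn_of_memLp_two (hfin 1) huS.memLp
  have hconv : ∀ ψ, IsTestFunction (Metric.ball (0 : Rn N) (1 / 2)) ψ →
      Filter.Tendsto (fun n => ∫ x, U n x * ψ x) Filter.atTop
        (nhds (∫ x in Metric.ball (0 : Rn N) (1 / 2), u x * ψ x)) := by
    intro ψ hψ
    have h := tendsto_integral_mollify_mul (tendsto_mollifierSeq_rOut N)
      ((integrable_indicator_iff measurableSet_ball).mpr hu1) hψ.contDiff.continuous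
      hψ.hasCompactSupport
    rw [← hψ.setIntegral_mul] at h
    have e : ∫ x in Metric.ball (0 : Rn N) (1 / 2), (Metric.ball 0 1).indicator u x * ψ x =
        ∫ x in Metric.ball (0 : Rn N) (1 / 2), u x * ψ x :=
      setIntegral_congr_fun measurableSet_ball fun x hx => by
        simp only [Set.indicator_of_mem (hsub hx)]
    rwa [e] at h
  exact exists_weakDeriv_of_bounded (hfin _) (hu1.mono_set hsub).locallyIntegrableOn hUs
    (mul_nonneg hC (add_nonneg hu0 hf0)) (fun n => hUb n α (by omega)) hconv

end InteriorReg

end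

theorem mainTheorem3 (N m l : ℕ) (hN : 1 ≤ N) (hm : 1 ≤ m) (M lam : ℝ) (hlam : 0 < lam) :
    ∃ C : ℝ, 0 < C ∧
      ∀ a : InteriorReg.Coeff N,
        InteriorReg.IsSymm m a →
        InteriorReg.IsEllipticWith m lam a →
        (∀ α ∈ InteriorReg.multiIdx N m, ∀ β ∈ InteriorReg.multiIdx N m, |a α β| ≤ M) →
        ∀ u f : InteriorReg.Rn N → ℝ,
          InteriorReg.MemSobolev l (Metric.ball 0 1) f →
          InteriorReg.IsWeakSolution m a (Metric.ball 0 1) u f →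
          InteriorReg.MemSobolev (2 * m + l) (Metric.ball 0 (1 / 2)) u ∧
          InteriorReg.sobolevNorm (2 * m + l) (Metric.ball 0 (1 / 2)) u ≤
            C * (InteriorReg.sobolevNorm m (Metric.ball 0 1) u +
              InteriorReg.sobolevNorm l (Metric.ball 0 1) f) := by
  obtain ⟨C, hC, hbound⟩ := InteriorReg.exists_interior_bound (N := N) hm l M hlam
  have hS : 0 ≤ Real.sqrt (∑ j ∈ Finset.range (2 * m + l + 1),
    ((InteriorReg.multiIdx N j).card : ℝ)) := Real.sqrt_nonneg _
  refine ⟨_, add_pos_of_nonneg_of_pos (mul_nonneg hS hC) one_pos, fun a _ ha haM u f hf hu => ?_⟩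
  have hu0 : 0 ≤ InteriorReg.sobolevNorm m (Metric.ball 0 1) u := Real.sqrt_nonneg _
  have hf0 : 0 ≤ InteriorReg.sobolevNorm l (Metric.ball 0 1) f := Real.sqrt_nonneg _
  have hex := hbound a ha haM u f hf hu
  constructor
  · refine ⟨hu.memSobolev.memLp.mono_measure (Measure.restrict_mono
      (Metric.ball_subset_ball (by norm_num)) le_rfl), fun α hα => ?_⟩
    obtain ⟨v, hv, hv2, -⟩ := hex α hα
    exact ⟨v, hv, hv2⟩
  · refine (InteriorReg.sobolevNorm_le (mul_nonneg hC (add_nonneg hu0 hf0)) fun α hα => ?_).trans ?_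
    · obtain ⟨v, hv, hv2, hle⟩ := hex α hα
      have hae := hv.weakDeriv_ae_eq Metric.isOpen_ball
      rwa [← toReal_eLpNorm ((memLp_congr_ae hae).mpr hv2).1, eLpNorm_congr_ae hae,
        toReal_eLpNorm hv2.1]
    · rw [← mul_assoc, add_mul, one_mul]
      exact le_add_of_nonneg_right (add_nonneg hu0 hf0)
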